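/- **Setting.** A server delivers files of $F>0$ bits to $K$ users over a block-fading broadcast channel. The channel states $\mathbf h(0),\mathbf h(1),\dots$ are i.i.d. in a finite set $\mathcal H$ of vectors of positive gains, with probabilities $\phi_{\mathbf h}$. A slot has $T_{\rm slot}>0$ channel uses and the transmit power is $P>0$. Caches are filled by decentralized placement with normalized memory $m\in[0,1]$. Index sets $I,J$ below are nonempty subsets of $\{1,\dots,K\}$. For $I\subseteq J$ let $b_{J,I}=m^{|I|-1}(1-m)^{|J|-|I|+1}F$; this is the length of the codeword for $I$ when one file of each user in $J$ is combined. For $h_1\ge\dots\ge h_K$, the capacity region $\Gamma(\mathbf h)$ is the set of all $(R_J)_J\ge 0$ for which there are $p_1,\dots,p_K\ge 0$ with $\sum_k p_k\le P$ and $$\sum_{J\subseteq\{1,\dots,k\},\,k\in J}R_J\le\log_2\frac{1+h_k\sum_{j\le k}p_j}{1+h_k\sum_{j<k}p_j}\qquad(k=1,\dots,K).$$ For other gain vectors the users are first sorted by decreasing gain. A *scheme* chooses in each slot $t$, from the past, the current channel state and extra randomness (but not from future channel states), admissions $a_k(t)\in\mathbb N$, combinations $\sigma_J(t)\in\{0,\dots,\sigma_{\max}\}$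 with $\sigma_{\max}\ge1$, and rates $\mu(t)\in\Gamma(\mathbf h(t))$. It also chooses how the $\min\{S_k(t),\sum_{J\ni k}\sigma_J(t)\}$ files taken from user queue $k$ are distributed over the combinations for the sets $J\ni k$, with at most $\sigma_J(t)$ of them going to $J$. The queues start empty and evolve by $$S_k(t+1)=\Big[S_k(t)-\sum_{J\ni k}\sigma_J(t)\Big]^++a_k(t),\qquad Q_I(t+1)=\big[Q_I(t)-T_{\rm slot}\mu_I(t)\big]^++\sum_{J\supseteq I}b_{J,I}\sigma_J(t).$$ Codeword queues are first-in-first-out, and the codewords that enter a queue in the same slot are transmitted as one block. A file of user $k$ combined for $J$ is delivered once all codewords of that combination for the sets $I$ with $k\in I\subseteq J$ have been transmitted. Let $D_k(t)$ be the number of files delivered to $k$ before slot $t$. Codeword generation is *irrevocable* if, almost surely and for every $k$, only $o(t)$ of these $D_k(t)$ files belong to combinations some of whose codewords (for any $I\subseteq J$) have not been transmitted before slot $t$. All rate vectors are in $\mathbb R_{\ge0}^K$, and interior, boundary and closure are taken in this space. * $\Lambda^{CC}$ is the set of $\overline{\mathbf r}$ for which some irrevocable scheme has $\overline r_k=\liminf_{t\to\infty}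 D_k(t)/t$ almost surely for every $k$. * The *stability region* is the set of $\overline{\mathbf a}$ for which some scheme has $\lim_{T\to\infty}\frac1T\sum_{t<T}\mathbb E[a_k(t)]=\overline a_k$ for every $k$ and all queues strongly stable, that is, $\limsup_{T\to\infty}\frac1T\sum_{t<T}\mathbb E[S_k(t)]<\infty$ for every $k$ and $\limsup_{T\to\infty}\frac1T\sum_{t<T}\mathbb E[Q_I(t)]<\infty$ for every $I$. * $\Gamma^{CC}$ is the set of $\overline{\mathbf a}$ for which there are $\overline\mu\in\sum_{\mathbf h}\phi_{\mathbf h}\Gamma(\mathbf h)$ and $\overline\sigma_J\in[0,\sigma_{\max}]$ with $\sum_{J\ni k}\overline\sigma_J\ge\overline a_k$ for all $k$ and $T_{\rm slot}\overline\mu_I\ge\sum_{J\supseteq I}b_{J,I}\overline\sigma_J$ for all $I$. **Lemma 1.** Boundary points of $\Gamma^{CC}$ being disregarded, $\Lambda^{CC}$, the stability region and $\operatorname{Int}\Gamma^{CC}$ coincide: $$\Lambda^{CC}\setminus\partial\Gamma^{CC}=\operatorname{Int}\Gamma^{CC}=(\text{stability region})\setminus\partial\Gamma^{CC}.$$ If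 $T_{\rm slot}\sum_{\mathbf h}\phi_{\mathbf h}\log_2(1+Ph_k)\le(1-m)F\sigma_{\max}$ for every $k$, then the same holds for the set of delivery rate vectors of all schemes, irrevocable or not. **Corollary 1.** Let $g_k(x)=\frac{(d_k+x)^{1-\alpha_k}}{1-\alpha_k}$ if $\alpha_k\ne1$ and $g_k(x)=\log(1+x/d_k)$ if $\alpha_k=1$, where $\alpha_k\ge0$ and $d_k>0$. Then $\sup\sum_kg_k(\overline r_k)$ over $\overline{\mathbf r}\in\Lambda^{CC}$ equals $\sup\sum_kg_k(\overline a_k)$ over the admission rate vectors $\overline{\mathbf a}$ of schemes that keep the system stable. This value $v$ is finite, and the vectors in the closure of $\Lambda^{CC}$ at which the utility equals $v$ are exactly the vectors in the closure of the stability region at which it equals $v$; there is at least one such vector. -/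

import Mathlib

open MeasureTheory Filter Topology
open scoped NNReal ENNReal

noncomputable section

/-- The nonempty sets of users: the `2 ^ K - 1` possible multicast groups. -/
abbrev UserGroup (K : ℕ) : Type := {J : Finset (Fin K) // J.Nonempty}

/-- Parameters of the content delivery system with `K` users. -/
structure CachingSystem (K : ℕ) where
  /-- number of channel states; the finite state space is `Fin numStates` -/
  numStates : ℕ
  /-- `gain s k` is the fading gain of user `k` when the channel is in state `s` -/
  gain : Fin numStates → Fin K → ℝ
  gain_pos : ∀ s k, 0 < gain s k
  /-- `φ s` is the probability of the channel state `s` in a slot -/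
  φ : Fin numStates → ℝ
  φ_nonneg : ∀ s, 0 ≤ φ s
  φ_sum : ∑ s, φ s = 1
  /-- transmit power -/
  P : ℝ
  P_pos : 0 < P
  /-- channel uses per slot -/
  Tslot : ℝ
  Tslot_pos : 0 < Tslot
  /-- file size in bits -/
  F : ℝ
  F_pos : 0 < F
  /-- normalized cache memory -/
  m : ℝ
  m_nonneg : 0 ≤ m
  m_le_one : m ≤ 1
  /-- largest number of combinations per slot and user set -/
  σmax : ℕ
  σmax_pos : 0 < σmax

/-- The users listed by decreasing gain (ties broken by index): `gainOrder h 0` is the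
strongest user. -/
def gainOrder {K : ℕ} (h : Fin K → ℝ) : Equiv.Perm (Fin K) :=
  Tuple.sort fun k => -h k

/-- Multicast capacity region (in bits per channel use) of the degraded Gaussian broadcast
channel with gains `h`, power `P` and one message for each nonempty set of users. The index
`i` runs over the users from the strongest to the weakest one. -/
def capacityRegion {K : ℕ} (P : ℝ) (h : Fin K → ℝ) : Set (UserGroup K → ℝ) :=
  {R | (∀ J, 0 ≤ R J) ∧
    ∃ p : Fin K → ℝ, (∀ i, 0 ≤ p i) ∧ ∑ i, p i ≤ P ∧
      ∀ i : Fin K,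
        ∑ J : UserGroup K with gainOrder h i ∈ J.1 ∧
            J.1 ⊆ (Finset.Iic i).map (gainOrder h).toEmbedding, R J
          ≤ Real.logb 2 ((1 + h (gainOrder h i) * ∑ j ∈ Finset.Iic i, p j) /
              (1 + h (gainOrder h i) * ∑ j ∈ Finset.Iio i, p j))}

/-- Backlog of a user queue (in files), initially empty, with `a t` files admitted and `c t`
files requested for combination in slot `t` (truncated subtraction is the positive part). -/
def userBacklog (a c : ℕ → ℕ) : ℕ → ℕ
  | 0 => 0
  | t + 1 => (userBacklog a c t - c t) + a t

/-- Backlog of a codeword queue (in bits), initially empty, with `arr t` bits arriving and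
service offered for `srv t` bits in slot `t`. -/
def codewordBacklog (arr srv : ℕ → ℝ) : ℕ → ℝ
  | 0 => 0
  | t + 1 => max (codewordBacklog arr srv t - srv t) 0 + arr t

namespace CachingSystem

variable {K : ℕ} (sys : CachingSystem K)

/-- Length in bits of the codeword for the group `I ⊆ J` when decentralized coded caching is
applied to one file for each user of `J`. A bit of the file of `k ∈ I` belongs to it
if, among the users of `J`, exactly those in `I \ {k}` have cached that bit. -/
def b (J I : UserGroup K) : ℝ :=
  sys.m ^ (I.1.card - 1) * (1 - sys.m) ^ (J.1.card - I.1.card + 1) * sys.F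

/-- The set of average rate vectors `∑ s, φ s • Γ(h s)`. -/
def ergodicCapacity : Set (UserGroup K → ℝ) :=
  {μ | ∃ ν : Fin sys.numStates → UserGroup K → ℝ,
    (∀ s, ν s ∈ capacityRegion sys.P (sys.gain s)) ∧ μ = ∑ s, sys.φ s • ν s}

/-- The region `Γ^CC`. Rate vectors live in the nonnegative orthant. -/
def Γcc : Set (Fin K → ℝ≥0) :=
  {a | ∃ μ ∈ sys.ergodicCapacity, ∃ σ : UserGroup K → ℝ,
    (∀ J, 0 ≤ σ J ∧ σ J ≤ sys.σmax) ∧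
    (∀ k, (a k : ℝ) ≤ ∑ J : UserGroup K with k ∈ J.1, σ J) ∧
    (∀ I : UserGroup K,
      ∑ J : UserGroup K with I.1 ⊆ J.1, sys.b J I * σ J ≤ sys.Tslot * μ I)}

/-- A file admission, combining and transmission scheme over the i.i.d. fading channel.
Decisions in slot `t` may depend on the past, on the current channel state and on additional
randomness, but not on future channel states. -/
structure Scheme where
  Ω : Type
  [mΩ : MeasurableSpace Ω]
  prob : Measure Ω
  [isProb : IsProbabilityMeasure prob]
  /-- information available in slot `t` -/
  ℱ : Filtration ℕ mΩ
  /-- channel state in slot `t` -/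
  h : ℕ → Ω → Fin sys.numStates
  h_adapted : ∀ t, Measurable[ℱ t] (h t)
  h_law : ∀ t s, prob (h t ⁻¹' {s}) = ENNReal.ofReal (sys.φ s)
  h_indep : ∀ t, ProbabilityTheory.Indep (ℱ t) (MeasurableSpace.comap (h (t + 1)) ⊤) prob
  /-- number of files admitted for each user -/
  a : ℕ → Ω → Fin K → ℕ
  a_adapted : ∀ t, Measurable[ℱ t] (a t)
  /-- number of combinations made for each group -/
  σ : ℕ → Ω → UserGroup K → ℕ
  σ_adapted : ∀ t, Measurable[ℱ t] (σ t)
  σ_le : ∀ t ω J, σ t ω J ≤ sys.σmax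
  /-- multicast rates in bits per channel use -/
  μ : ℕ → Ω → UserGroup K → ℝ
  μ_adapted : ∀ t, Measurable[ℱ t] (μ t)
  μ_mem : ∀ t ω, μ t ω ∈ capacityRegion sys.P (sys.gain (h t ω))
  /-- `x t ω k J` is the number of files of user `k` that are put into the combinations for the
  group `J`. Combinations in excess of the backlog contain no file of that user. -/
  x : ℕ → Ω → Fin K → UserGroup K → ℕ
  x_adapted : ∀ t, Measurable[ℱ t] (x t)
  x_le : ∀ t ω k J, x t ω k J ≤ if k ∈ J.1 then σ t ω J else 0
  x_sum : ∀ t ω k, ∑ J, x t ω k J =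
    min (userBacklog (fun s => a s ω k)
          (fun s => ∑ J : UserGroup K with k ∈ J.1, σ s ω J) t)
      (∑ J : UserGroup K with k ∈ J.1, σ t ω J)

attribute [instance] Scheme.mΩ Scheme.isProb

namespace Scheme

variable {sys}
variable (π : Scheme sys)

/-- Backlog `S_k(t)` of the user queue of `k`. -/
def S (k : Fin K) (t : ℕ) (ω : π.Ω) : ℕ :=
  userBacklog (fun s => π.a s ω k)
    (fun s => ∑ J : UserGroup K with k ∈ J.1, π.σ s ω J) t

/-- Bits put into the codeword queue of `I` in slot `t`. -/
def arrivals (I : UserGroup K) (t : ℕ) (ω : π.Ω) : ℝ :=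
  ∑ J : UserGroup K with I.1 ⊆ J.1, sys.b J I * π.σ t ω J

/-- Backlog `Q_I(t)` of the codeword queue of `I`. -/
def Q (I : UserGroup K) (t : ℕ) (ω : π.Ω) : ℝ :=
  codewordBacklog (fun s => π.arrivals I s ω) (fun s => sys.Tslot * π.μ s ω I) t

/-- Bits put into the codeword queue of `I` before slot `t`. -/
def created (I : UserGroup K) (t : ℕ) (ω : π.Ω) : ℝ :=
  ∑ s ∈ Finset.range t, π.arrivals I s ω

/-- Bits that have left the codeword queue of `I` before slot `t`. -/
def sent (I : UserGroup K) (t : ℕ) (ω : π.Ω) : ℝ :=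
  π.created I t ω - π.Q I t ω

/-- All codewords put into the queue of `I` in slot `s` have been multicast before slot `t`.
Codeword queues are first-in-first-out. -/
def Transmitted (I : UserGroup K) (s t : ℕ) (ω : π.Ω) : Prop :=
  π.created I (s + 1) ω ≤ π.sent I t ω

open Classical in
/-- Number `D_k(t)` of files delivered to user `k` before slot `t`. A file combined in slot `s`
for the group `J` is delivered to `k` once all the codewords intended for `k` among those
of the combination have been multicast. -/
def delivered (k : Fin K) (t : ℕ) (ω : π.Ω) : ℕ :=
  ∑ s ∈ Finset.range t, ∑ J : UserGroup K,
    if ∀ I : UserGroup K, k ∈ I.1 → I.1 ⊆ J.1 → π.Transmitted I s t ω then π.x s ω k J else 0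

open Classical in
/-- Those files among the ones of user `k` whose combination has been carried through: all its
codewords, including those intended for other users only, have been multicast. -/
def carriedThrough (k : Fin K) (t : ℕ) (ω : π.Ω) : ℕ :=
  ∑ s ∈ Finset.range t, ∑ J : UserGroup K,
    if ∀ I : UserGroup K, I.1 ⊆ J.1 → π.Transmitted I s t ω then π.x s ω k J else 0

/-- Codeword generation is irrevocable: a combination out of which some user has been served
is not abandoned. In the long run the combinations that serve a user but are
carried through only in part have rate zero. -/
def Irrevocable : Prop :=
  ∀ᵐ ω ∂π.prob, ∀ k, Tendsto
    (fun t : ℕ => ((π.delivered k t ω : ℝ) - (π.carriedThrough k t ω : ℝ)) / (t : ℝ))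
    atTop (𝓝 0)

/-- The scheme has the delivery rate vector `r`. -/
def HasDeliveryRate (r : Fin K → ℝ≥0) : Prop :=
  ∀ᵐ ω ∂π.prob, ∀ k,
    liminf (fun t : ℕ => (π.delivered k t ω : ℝ≥0∞) / (t : ℝ≥0∞)) atTop = (r k : ℝ≥0∞)

/-- The scheme has the (long-term expected) admission rate vector `a`. -/
def HasAdmissionRate (a : Fin K → ℝ≥0) : Prop :=
  ∀ k, Tendsto
    (fun T : ℕ => (∑ t ∈ Finset.range T, ∫⁻ ω, (π.a t ω k : ℝ≥0∞) ∂π.prob) / (T : ℝ≥0∞))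
    atTop (𝓝 (a k : ℝ≥0∞))

/-- All user queues and codeword queues are strongly stable. -/
def Stable : Prop :=
  (∀ k, limsup (fun T : ℕ =>
      (∑ t ∈ Finset.range T, ∫⁻ ω, (π.S k t ω : ℝ≥0∞) ∂π.prob) / (T : ℝ≥0∞)) atTop < ⊤) ∧
  (∀ I, limsup (fun T : ℕ =>
      (∑ t ∈ Finset.range T, ∫⁻ ω, ENNReal.ofReal (π.Q I t ω) ∂π.prob) / (T : ℝ≥0∞)) atTop < ⊤)

end Scheme

/-- The region `Λ^CC` of feasible delivery rate vectors. -/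
def Λcc : Set (Fin K → ℝ≥0) :=
  {r | ∃ π : Scheme sys, π.Irrevocable ∧ π.HasDeliveryRate r}

/-- The delivery rate vectors of all schemes, including those that abandon combinations
half-way. -/
def ΛccRevocable : Set (Fin K → ℝ≥0) :=
  {r | ∃ π : Scheme sys, π.HasDeliveryRate r}

/-- The stability region of the queueing system. -/
def stabilityRegion : Set (Fin K → ℝ≥0) :=
  {a | ∃ π : Scheme sys, π.HasAdmissionRate a ∧ π.Stable}

end CachingSystem

/-- The alpha-fair utility function, shifted by `d`. -/
def alphaFair (α d x : ℝ) : ℝ :=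
  if α = 1 then Real.log (1 + x / d) else (d + x) ^ (1 - α) / (1 - α)

/-- Total utility of a rate vector. -/
def totalUtility {K : ℕ} (α d : Fin K → ℝ) (r : Fin K → ℝ≥0) : ℝ :=
  ∑ k, alphaFair (α k) (d k) (r k)

end

noncomputable section

/-! ### The capacity region as a sublevel set of the required power -/

/-! Everything reduces to the sandwich `interior Γcc ⊆ A ⊆ Γcc`, for `A` each of the regions in
question, together with the fact that `Γcc` is compact and is the closure of its interior. Removing
the frontier then leaves exactly the interior, and a continuous utility has the same supremum and
the same limiting maximizers for all such `A`, because all have the closure `Γcc`.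

Geometry: superposition coding supports rates iff `requiredPower` is at most `P`. Since the
noise-to-gain ratios increase along the gain order, Abel summation makes this power a nonnegative
combination of the exponentials `2 ^ tailRate`, up to a constant. Hence the capacity region is
convex and compact, and rate may be moved from a group to its subgroups.

Upper bounds: expectations are averaged up to one late slot. Mean rates lie in `ergodicCapacity` by
convexity, and queue balances give the inequalities of `Γcc` up to a small error. For deliveries, a
combination for `J` of which only the users in `U` have been served is recounted as a combination
for `U`: a codeword for `I'` acts as one for `U ∩ I'`, and by the binomial theorem the lengths match
(`sum_b_inter_eq`). Recounting could push a frequency above `σmax`; irrevocability avoids it, and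
the single-user capacity condition excludes it.

Lower bound: an interior point can be served with slack. Admissions and combinations follow
deterministic floor sequences, and the rates depend on the current channel state only. The strong
law makes the codeword backlogs `o(t)`, which gives the delivery rates; a quadratic Lyapunov
function gives strong stability. -/

lemma abel_sum_nonneg {K : ℕ} {n D : ℕ → ℝ} (hn : ∀ i < K, 0 ≤ n i)
    (hmono : ∀ i, i + 1 < K → n i ≤ n (i + 1)) (hD : ∀ i < K, 0 ≤ D i) (hK : D K = 0) :
    0 ≤ ∑ i ∈ Finset.range K, n i * (D i - D (i + 1)) := by
  rcases K with _ | K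
  · simp
  -- Summation by parts with the boundary term carried along: monotonicity of `n` absorbs it at each
  -- step, and it vanishes at the last index.
  have key : ∀ m, m < K + 1 →
      -(n m * D (m + 1)) ≤ ∑ i ∈ Finset.range (m + 1), n i * (D i - D (i + 1)) := by
    intro m
    induction m with
    | zero =>
      intro h
      have := mul_nonneg (hn 0 h) (hD 0 h)
      simp; linarith
    | succ m ih =>
      intro h
      have h1 := ih (by omega)
      have h2 := mul_le_mul_of_nonneg_right (hmono m h) (hD (m + 1) h)
      rw [Finset.sum_range_succ]
      linarith
  have := key K (by omega)
  rwa [hK, mul_zero, neg_zero] at this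

/-- Clearing the denominator turns the hypothesis into `n i * (E i - E (i + 1)) ≤ E (i + 1) * q (i +
1) - E i * q i`, which telescopes. In the application `q` is the accumulated power. -/
lemma power_lower_bound {K : ℕ} {n E q : ℕ → ℝ} (hE : ∀ i, 0 < E i) (hq : q 0 = 0)
    (h : ∀ i < K, E i / E (i + 1) * (n i + q i) ≤ n i + q (i + 1)) :
    ∑ i ∈ Finset.range K, n i * (E i - E (i + 1)) ≤ E K * q K := by
  induction K with
  | zero => simp [hq]
  | succ K ih =>
    have h1 := ih fun i hi => h i (by omega)
    have h2 := mul_le_mul_of_nonneg_left (h K (by omega)) (hE (K + 1)).le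
    have h3 : E (K + 1) * (E K / E (K + 1) * (n K + q K)) = E K * (n K + q K) := by
      have := (hE (K + 1)).ne'
      field_simp
    rw [Finset.sum_range_succ]
    linarith

lemma sum_Iic_fin {K : ℕ} (f : ℕ → ℝ) (i : Fin K) :
    ∑ j ∈ Finset.Iic i, f j = ∑ j ∈ Finset.range (i + 1), f j := by
  have := Finset.sum_map (Finset.Iic i) Fin.valEmbedding f
  rw [Fin.map_valEmbedding_Iic] at this
  rw [← Nat.Iio_eq_range]
  exact this.symm

lemma sum_Iio_fin {K : ℕ} (f : ℕ → ℝ) (i : Fin K) :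
    ∑ j ∈ Finset.Iio i, f j = ∑ j ∈ Finset.range i, f j := by
  have := Finset.sum_map (Finset.Iio i) Fin.valEmbedding f
  rw [Fin.map_valEmbedding_Iio] at this
  rw [← Nat.Iio_eq_range]
  exact this.symm

section

variable {K : ℕ}

/-- Total rate of the groups that contain one of the users in the positions `i, i + 1, …`
of the gain order. -/
def tailRate (h : Fin K → ℝ) (R : UserGroup K → ℝ) (i : ℕ) : ℝ :=
  ∑ J : UserGroup K with ∃ j : Fin K, i ≤ j ∧ gainOrder h j ∈ J.1, R J

/-- Noise-to-gain ratio of the user in position `i` of the gain order. -/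
def sortedNoise (h : Fin K → ℝ) (i : ℕ) : ℝ :=
  if hi : i < K then (h (gainOrder h ⟨i, hi⟩))⁻¹ else 0

/-- The least power at which superposition coding supports the rates `R`. -/
def requiredPower (h : Fin K → ℝ) (R : UserGroup K → ℝ) : ℝ :=
  ∑ i ∈ Finset.range K,
    sortedNoise h i * ((2 : ℝ) ^ tailRate h R i - (2 : ℝ) ^ tailRate h R (i + 1))

lemma tailRate_eq_zero (h : Fin K → ℝ) (R : UserGroup K → ℝ) : tailRate h R K = 0 := by
  unfold tailRate
  rw [Finset.filter_false_of_mem, Finset.sum_empty]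
  rintro J - ⟨j, hj, -⟩
  omega

/-- A group that meets the positions from `i` on either meets those from `i + 1` on or has its
weakest user exactly in position `i`. -/
lemma tailRate_eq_add (h : Fin K → ℝ) (R : UserGroup K → ℝ) (i : Fin K) :
    tailRate h R i = (∑ J : UserGroup K with gainOrder h i ∈ J.1 ∧
        J.1 ⊆ (Finset.Iic i).map (gainOrder h).toEmbedding, R J) + tailRate h R (i + 1) := by
  unfold tailRate
  rw [← Finset.sum_union]
  · congr 1
    ext J
    simp only [Finset.mem_filter, Finset.mem_univ, true_and, Finset.mem_union]
    constructor
    · rintro ⟨j, hj, hjJ⟩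
      by_cases hc : ∃ j : Fin K, (i : ℕ) + 1 ≤ j ∧ gainOrder h j ∈ J.1
      · exact Or.inr hc
      · left
        push Not at hc
        have : j = i := by
          by_contra hne
          refine hc j ?_ hjJ
          have : (j : ℕ) ≠ i := fun h => hne (Fin.ext h)
          omega
        subst this
        refine ⟨hjJ, fun k hk => ?_⟩
        simp only [Finset.mem_map_equiv, Finset.mem_Iic]
        by_contra hlt
        refine hc ((gainOrder h).symm k) ?_ (by simpa using hk)
        have : j < (gainOrder h).symm k := not_le.1 hlt
        exact this
    · rintro (⟨h1, -⟩ | ⟨j, hj, hjJ⟩)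
      · exact ⟨i, le_rfl, h1⟩
      · exact ⟨j, by omega, hjJ⟩
  · rw [Finset.disjoint_filter]
    rintro J - ⟨-, hsub⟩ ⟨j, hj, hjJ⟩
    have := hsub hjJ
    simp only [Finset.mem_map_equiv, Finset.mem_Iic, Equiv.symm_apply_apply, Fin.le_def] at this
    omega

lemma sortedNoise_of_lt (h : Fin K → ℝ) (i : Fin K) :
    sortedNoise h i = (h (gainOrder h i))⁻¹ := by
  simp [sortedNoise]

lemma sortedNoise_pos {h : Fin K → ℝ} (hpos : ∀ k, 0 < h k) {i : ℕ} (hi : i < K) :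
    0 < sortedNoise h i := by
  simp [sortedNoise, hi, hpos]

lemma sortedNoise_mono {h : Fin K → ℝ} (hpos : ∀ k, 0 < h k) {i : ℕ} (hi : i + 1 < K) :
    sortedNoise h i ≤ sortedNoise h (i + 1) := by
  have hi' : i < K := by omega
  simp only [sortedNoise, hi, hi', dite_true]
  have := Tuple.monotone_sort (fun k => -h k)
    (show (⟨i, hi'⟩ : Fin K) ≤ ⟨i + 1, hi⟩ from Nat.le_succ i)
  simp only [Function.comp, neg_le_neg_iff] at this
  exact inv_anti₀ (hpos _) this

lemma le_logb_iff_power {g a b ρ : ℝ} (hg : 0 < g) (ha : 0 ≤ a) (hb : 0 ≤ b) :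
    ρ ≤ Real.logb 2 ((1 + g * b) / (1 + g * a)) ↔ (2 : ℝ) ^ ρ * (g⁻¹ + a) ≤ g⁻¹ + b := by
  have h1 : 0 < 1 + g * a := by positivity
  have h2 : 0 < 1 + g * b := by positivity
  rw [Real.le_logb_iff_rpow_le (by norm_num) (by positivity), le_div_iff₀ h1]
  have e1 : (2 : ℝ) ^ ρ * (1 + g * a) = g * ((2 : ℝ) ^ ρ * (g⁻¹ + a)) := by field_simp
  have e2 : 1 + g * b = g * (g⁻¹ + b) := by field_simp
  rw [e1, e2, mul_le_mul_iff_right₀ hg]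

theorem mem_capacityRegion_iff {P : ℝ} {h : Fin K → ℝ} (hpos : ∀ k, 0 < h k)
    {R : UserGroup K → ℝ} :
    R ∈ capacityRegion P h ↔ (∀ J, 0 ≤ R J) ∧ requiredPower h R ≤ P := by
  set E : ℕ → ℝ := fun i => (2 : ℝ) ^ tailRate h R i with hEdef
  have hE : ∀ i, 0 < E i := fun i => by positivity
  have hEK : E K = 1 := by simp [hEdef, tailRate_eq_zero]
  have hratio : ∀ i : Fin K, (2 : ℝ) ^ (∑ J : UserGroup K with gainOrder h i ∈ J.1 ∧
        J.1 ⊆ (Finset.Iic i).map (gainOrder h).toEmbedding, R J) = E i / E (i + 1) := by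
    intro i
    rw [hEdef]
    simp only
    rw [tailRate_eq_add, Real.rpow_add (by norm_num), mul_div_cancel_right₀ _ (hE _).ne']
  refine and_congr_right fun hR => ⟨?_, fun hP => ?_⟩
  · rintro ⟨p, hp, hpP, hrate⟩
    set p' : ℕ → ℝ := fun j => if hj : j < K then p ⟨j, hj⟩ else 0 with hp'
    have hpe : ∀ j : Fin K, p j = p' j := fun j => by simp [hp']
    have hp'0 : ∀ j, 0 ≤ p' j := fun j => by
      simp only [hp']; split_ifs <;> simp [hp]
    have h1 := power_lower_bound (K := K) (n := sortedNoise h) (E := E)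
      (q := fun i => ∑ j ∈ Finset.range i, p' j) hE (by simp) (by
        intro i hi
        have h2 := hrate ⟨i, hi⟩
        simp only [hpe] at h2
        rw [sum_Iic_fin, sum_Iio_fin, le_logb_iff_power (hpos _)
          (Finset.sum_nonneg fun j _ => hp'0 j) (Finset.sum_nonneg fun j _ => hp'0 j),
          hratio, ← sortedNoise_of_lt] at h2
        exact h2)
    rw [hEK, one_mul] at h1
    refine h1.trans (le_trans (le_of_eq ?_) hpP)
    simp only [hpe]
    exact (Fin.sum_univ_eq_sum_range p' K).symm
  -- Accumulated powers that meet every rate constraint with equality; `hstep` is the recursion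
  -- expressing this.
  · set q : ℕ → ℝ := fun m => (E m)⁻¹ * ∑ i ∈ Finset.range m, sortedNoise h i * (E i - E (i + 1))
      with hq
    have hq0 : q 0 = 0 := by simp [hq]
    have hstep : ∀ m, E m / E (m + 1) * (sortedNoise h m + q m) = sortedNoise h m + q (m + 1) := by
      intro m
      simp only [hq, Finset.sum_range_succ]
      have := (hE m).ne'
      have := (hE (m + 1)).ne'
      field_simp
      ring
    have hE1 : ∀ i : Fin K, 1 ≤ E i / E (i + 1) := fun i => by
      rw [← hratio]
      exact Real.one_le_rpow (by norm_num) (Finset.sum_nonneg fun J _ => hR J)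
    have hqm : ∀ m, m ≤ K → 0 ≤ q m ∧ ∀ i < m, q i ≤ q (i + 1) := by
      intro m
      induction m with
      | zero => intro _; simp [hq0]
      | succ m ih =>
        intro hm
        obtain ⟨i1, i2⟩ := ih (by omega)
        have h3 := hE1 ⟨m, by omega⟩
        have h4 := sortedNoise_pos hpos (i := m) (by omega)
        have h5 : q m ≤ q (m + 1) := by
          have h6 := mul_le_mul_of_nonneg_right h3 (show 0 ≤ sortedNoise h m + q m by linarith)
          have h7 := hstep m
          simp only at h6
          linarith
        refine ⟨i1.trans h5, fun i hi => ?_⟩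
        rcases Nat.lt_succ_iff_lt_or_eq.1 hi with hi | rfl
        · exact i2 i hi
        · exact h5
    set p : ℕ → ℝ := fun i => q (i + 1) - q i with hp
    have hsum : ∀ m, ∑ j ∈ Finset.range m, p j = q m := fun m => by
      rw [Finset.sum_range_sub, hq0, sub_zero]
    refine ⟨fun i => p i, fun i => sub_nonneg.2 ((hqm K le_rfl).2 i i.2), ?_, fun i => ?_⟩
    · rw [Fin.sum_univ_eq_sum_range, hsum]
      change (E K)⁻¹ * requiredPower h R ≤ P
      rwa [hEK, inv_one, one_mul]
    · rw [sum_Iic_fin, sum_Iio_fin, hsum, hsum, le_logb_iff_power (hpos _)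
        (hqm i i.2.le).1 (hqm (i + 1) i.2).1, hratio, ← sortedNoise_of_lt, hstep]

/-- After Abel summation the exponentials `2 ^ tailRate` enter the required power with nonnegative
coefficients, the noise being monotone along the gain order. -/
lemma requiredPower_le_of_dominated {h : Fin K → ℝ} (hpos : ∀ k, 0 < h k)
    {R R' : UserGroup K → ℝ} (ht : ∀ i, tailRate h R' i ≤ tailRate h R i) :
    requiredPower h R' ≤ requiredPower h R := by
  have := abel_sum_nonneg (K := K) (n := sortedNoise h)
    (D := fun i => (2 : ℝ) ^ tailRate h R i - (2 : ℝ) ^ tailRate h R' i)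
    (fun i hi => (sortedNoise_pos hpos hi).le) (fun i hi => sortedNoise_mono hpos hi)
    (fun i _ => sub_nonneg.2 (Real.rpow_le_rpow_of_exponent_le (by norm_num) (ht i)))
    (by simp [tailRate_eq_zero])
  rw [← sub_nonneg]
  refine this.trans_eq ?_
  unfold requiredPower
  rw [← Finset.sum_sub_distrib]
  exact Finset.sum_congr rfl fun i _ => by ring

lemma tailRate_add_smul (h : Fin K → ℝ) (R R' : UserGroup K → ℝ) (a b : ℝ) (i : ℕ) :
    tailRate h (a • R + b • R') i = a * tailRate h R i + b * tailRate h R' i := by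
  simp [tailRate, Finset.sum_add_distrib, Finset.mul_sum]

/-- Abel summation again, now applied to the convexity gap of `2 ^ x` at each tail rate; the gap
vanishes at index `K` because the weights sum to one. -/
theorem convex_capacityRegion {P : ℝ} {h : Fin K → ℝ} (hpos : ∀ k, 0 < h k) :
    Convex ℝ (capacityRegion P h) := by
  intro R hR R' hR' a b ha hb hab
  rw [mem_capacityRegion_iff hpos] at *
  refine ⟨fun J => add_nonneg (mul_nonneg ha (hR.1 J)) (mul_nonneg hb (hR'.1 J)), ?_⟩
  have hconv : ConvexOn ℝ Set.univ fun x : ℝ => (2 : ℝ) ^ x := by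
    have : (fun x : ℝ => (2 : ℝ) ^ x) = fun x => Real.exp (Real.log 2 * x) := by
      ext x; rw [Real.rpow_def_of_pos (by norm_num)]
    rw [this]
    exact convexOn_exp.comp_linearMap (LinearMap.mul ℝ ℝ (Real.log 2))
  have := abel_sum_nonneg (K := K) (n := sortedNoise h)
    (D := fun i => a * (2 : ℝ) ^ tailRate h R i + b * (2 : ℝ) ^ tailRate h R' i
      - (2 : ℝ) ^ tailRate h (a • R + b • R') i)
    (fun i hi => (sortedNoise_pos hpos hi).le) (fun i hi => sortedNoise_mono hpos hi)
    (fun i _ => sub_nonneg.2 (by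
      have := hconv.2 (Set.mem_univ (tailRate h R i)) (Set.mem_univ (tailRate h R' i)) ha hb hab
      rw [tailRate_add_smul]
      simpa using this))
    (by simp [tailRate_eq_zero, hab])
  have e : ∑ i ∈ Finset.range K, sortedNoise h i *
      ((a * (2 : ℝ) ^ tailRate h R i + b * (2 : ℝ) ^ tailRate h R' i
      - (2 : ℝ) ^ tailRate h (a • R + b • R') i) -
      (a * (2 : ℝ) ^ tailRate h R (i + 1) + b * (2 : ℝ) ^ tailRate h R' (i + 1)
      - (2 : ℝ) ^ tailRate h (a • R + b • R') (i + 1)))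
      = a * requiredPower h R + b * requiredPower h R' - requiredPower h (a • R + b • R') := by
    unfold requiredPower
    rw [Finset.mul_sum, Finset.mul_sum, ← Finset.sum_add_distrib, ← Finset.sum_sub_distrib]
    exact Finset.sum_congr rfl fun i _ => by ring
  rw [e] at this
  have h1 := mul_le_mul_of_nonneg_left hR.2 ha
  have h2 := mul_le_mul_of_nonneg_left hR'.2 hb
  have h3 : a * P + b * P = P := by rw [← add_mul, hab, one_mul]
  linarith

lemma continuous_requiredPower (h : Fin K → ℝ) : Continuous (requiredPower h) := by
  have ht : ∀ i, Continuous fun R : UserGroup K → ℝ => tailRate h R i := fun i =>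
    continuous_finsetSum _ fun J _ => continuous_apply J
  unfold requiredPower
  refine continuous_finsetSum _ fun i _ => continuous_const.mul ?_
  exact (continuous_const.rpow (ht _) fun _ => Or.inl (by norm_num)).sub
    (continuous_const.rpow (ht _) fun _ => Or.inl (by norm_num))

theorem isClosed_capacityRegion {P : ℝ} {h : Fin K → ℝ} (hpos : ∀ k, 0 < h k) :
    IsClosed (capacityRegion P h) := by
  have : capacityRegion P h = {R | ∀ J, 0 ≤ R J} ∩ {R | requiredPower h R ≤ P} := by
    ext R; exact mem_capacityRegion_iff hpos
  rw [this]
  refine IsClosed.inter ?_ (isClosed_le (continuous_requiredPower h) continuous_const)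
  simp only [Set.ofPred_forall]
  exact isClosed_iInter fun J => isClosed_le continuous_const (continuous_apply J)

/-- A user receives at most the single-user capacity. -/
theorem sum_rate_le_of_mem_capacityRegion {P : ℝ} {h : Fin K → ℝ} (hpos : ∀ k, 0 < h k)
    {R : UserGroup K → ℝ} (hR : R ∈ capacityRegion P h) (k : Fin K) :
    ∑ J : UserGroup K with k ∈ J.1, R J ≤ Real.logb 2 (1 + P * h k) := by
  rw [mem_capacityRegion_iff hpos] at hR
  obtain ⟨hR0, hRP⟩ := hR
  set i := (gainOrder h).symm k with hi
  have hik : gainOrder h i = k := by simp [hi]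
  have hanti : ∀ j : ℕ, ∀ l : ℕ, j ≤ l → tailRate h R l ≤ tailRate h R j := fun j l hjl =>
    Finset.sum_le_sum_of_subset_of_nonneg
      (Finset.monotone_filter_right _ fun J _ ⟨x, hx, hxJ⟩ => ⟨x, hjl.trans hx, hxJ⟩)
      fun J _ _ => hR0 J
  have hnonneg : ∀ j, 0 ≤ tailRate h R j := fun j => Finset.sum_nonneg fun J _ => hR0 J
  have hle : ∑ J : UserGroup K with k ∈ J.1, R J ≤ tailRate h R i :=
    Finset.sum_le_sum_of_subset_of_nonneg
      (Finset.monotone_filter_right _ fun J _ hJ => ⟨i, le_rfl, by rwa [hik]⟩)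
      fun J _ _ => hR0 J
  -- The exponentials for a rate vector that hands the whole of `tailRate h R i` to the user in
  -- position `i`. They are dominated by those of `R`, and the power they need is explicit.
  set E' : ℕ → ℝ := fun j => if j ≤ i then (2 : ℝ) ^ tailRate h R i else 1 with hE'
  have := abel_sum_nonneg (K := K) (n := sortedNoise h)
    (D := fun j => (2 : ℝ) ^ tailRate h R j - E' j)
    (fun i hi => (sortedNoise_pos hpos hi).le) (fun i hi => sortedNoise_mono hpos hi)
    (fun j _ => sub_nonneg.2 (by
      simp only [hE']
      split_ifs with hj
      · exact Real.rpow_le_rpow_of_exponent_le (by norm_num) (hanti _ _ hj)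
      · exact Real.one_le_rpow (by norm_num) (hnonneg j)))
    (by simp [tailRate_eq_zero, hE', i.2.not_ge])
  have e : ∑ j ∈ Finset.range K, sortedNoise h j * ((2 : ℝ) ^ tailRate h R j - E' j -
      ((2 : ℝ) ^ tailRate h R (j + 1) - E' (j + 1))) =
      requiredPower h R - sortedNoise h i * ((2 : ℝ) ^ tailRate h R i - 1) := by
    have e1 : ∑ j ∈ Finset.range K, sortedNoise h j * (E' j - E' (j + 1)) =
        sortedNoise h i * ((2 : ℝ) ^ tailRate h R i - 1) := by
      rw [Finset.sum_eq_single (i : ℕ)]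
      · simp [hE']
      · intro j _ hj
        have : (j ≤ (i : ℕ)) ↔ (j + 1 ≤ (i : ℕ)) := by omega
        simp [hE', this]
      · intro hn; simp at hn
    rw [← e1, requiredPower, ← Finset.sum_sub_distrib]
    exact Finset.sum_congr rfl fun i _ => by ring
  rw [e, sortedNoise_of_lt, hik] at this
  refine hle.trans ?_
  have hk := hpos k
  have h2 : (h k)⁻¹ * ((2 : ℝ) ^ tailRate h R i - 1) ≤ P := by linarith
  rw [inv_mul_le_iff₀ hk] at h2
  have hP0 : 0 < 1 + P * h k := by
    have : (0:ℝ) < (2 : ℝ) ^ tailRate h R i := by positivity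
    linarith
  rw [Real.le_logb_iff_rpow_le (by norm_num) hP0]
  linarith

theorem isCompact_capacityRegion {P : ℝ} {h : Fin K → ℝ} (hpos : ∀ k, 0 < h k) :
    IsCompact (capacityRegion P h) := by
  refine (isCompact_univ_pi fun J : UserGroup K =>
    isCompact_Icc (a := (0 : ℝ)) (b := Real.logb 2 (1 + P * h J.2.choose))).of_isClosed_subset
    (isClosed_capacityRegion hpos) fun R hR J _ => ⟨hR.1 J, ?_⟩
  refine le_trans ?_ (sum_rate_le_of_mem_capacityRegion hpos hR J.2.choose)
  exact Finset.single_le_sum (f := R) (fun J _ => hR.1 J) (by simpa using J.2.choose_spec)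

/-- Rate may be reassigned from a group to its subgroups. -/
theorem degrade_mem_capacityRegion {P : ℝ} {h : Fin K → ℝ} (hpos : ∀ k, 0 < h k)
    {R : UserGroup K → ℝ} (hR : R ∈ capacityRegion P h) {w : UserGroup K → UserGroup K → ℝ}
    (hw : ∀ I I', 0 ≤ w I I') (hsub : ∀ I I', ¬ I'.1 ⊆ I.1 → w I I' = 0)
    (hsum : ∀ I, ∑ I', w I I' ≤ 1) :
    (fun I' => ∑ I, w I I' * R I) ∈ capacityRegion P h := by
  rw [mem_capacityRegion_iff hpos] at *
  obtain ⟨hR0, hRP⟩ := hR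
  refine ⟨fun J => Finset.sum_nonneg fun I _ => mul_nonneg (hw _ _) (hR0 _),
    le_trans (requiredPower_le_of_dominated hpos fun i => ?_) hRP⟩
  -- A subgroup reaching the tail comes from a group that already does, so no tail rate grows.
  unfold tailRate
  rw [Finset.sum_comm, Finset.sum_filter]
  refine Finset.sum_le_sum fun I _ => ?_
  rw [← Finset.sum_mul]
  split_ifs with hI
  · refine mul_le_of_le_one_left (hR0 I) (le_trans ?_ (hsum I))
    exact Finset.sum_le_sum_of_subset_of_nonneg (Finset.filter_subset _ _) fun _ _ _ => hw _ _
  · rw [Finset.sum_eq_zero, zero_mul]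
    intro I' hI'
    obtain ⟨j, hj, hjI⟩ := (Finset.mem_filter.1 hI').2
    exact hsub _ _ fun hs => hI ⟨j, hj, hs hjI⟩

lemma zero_mem_capacityRegion {P : ℝ} (hP : 0 ≤ P) {h : Fin K → ℝ} (hpos : ∀ k, 0 < h k) :
    (0 : UserGroup K → ℝ) ∈ capacityRegion P h := by
  rw [mem_capacityRegion_iff hpos]
  simpa [requiredPower, tailRate] using hP

/-- Some positive rate is available to all groups simultaneously. -/
lemma exists_const_mem_capacityRegion {P : ℝ} (hP : 0 < P) {h : Fin K → ℝ}
    (hpos : ∀ k, 0 < h k) :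
    ∀ᶠ δ : ℝ in 𝓝[>] 0, (fun _ => δ) ∈ capacityRegion P h := by
  have hc : Continuous fun δ : ℝ => requiredPower h (fun _ : UserGroup K => δ) :=
    (continuous_requiredPower h).comp (continuous_pi fun _ => continuous_id)
  have h0 : requiredPower h (fun _ : UserGroup K => (0 : ℝ)) < P := by
    simpa [requiredPower, tailRate] using hP
  have := (hc.tendsto 0).eventually (gt_mem_nhds h0)
  filter_upwards [nhdsWithin_le_nhds this, self_mem_nhdsWithin] with δ h1 h2
  rw [mem_capacityRegion_iff hpos]
  exact ⟨fun _ => le_of_lt h2, h1.le⟩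

end

/-! ### The ergodic capacity region and the region `Γcc` -/

namespace CachingSystem

variable {K : ℕ} (sys : CachingSystem K)

lemma b_nonneg (J I : UserGroup K) : 0 ≤ sys.b J I := by
  have := sys.m_nonneg
  have := sub_nonneg.2 sys.m_le_one
  have := sys.F_pos
  unfold b
  positivity

theorem convex_ergodicCapacity : Convex ℝ sys.ergodicCapacity := by
  rintro _ ⟨ν, hν, rfl⟩ _ ⟨ν', hν', rfl⟩ a b ha hb hab
  refine ⟨fun s => a • ν s + b • ν' s,
    fun s => convex_capacityRegion (sys.gain_pos s) (hν s) (hν' s) ha hb hab, ?_⟩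
  rw [Finset.smul_sum, Finset.smul_sum, ← Finset.sum_add_distrib]
  refine Finset.sum_congr rfl fun s _ => ?_
  rw [smul_add, smul_comm a, smul_comm b]

theorem isCompact_ergodicCapacity : IsCompact sys.ergodicCapacity := by
  have h1 : IsCompact (Set.univ.pi fun s => capacityRegion sys.P (sys.gain s)) :=
    isCompact_univ_pi fun s => isCompact_capacityRegion (sys.gain_pos s)
  have h2 : Continuous fun ν : Fin sys.numStates → UserGroup K → ℝ => ∑ s, sys.φ s • ν s := by
    fun_prop
  convert h1.image h2 using 1
  ext μ
  simp [ergodicCapacity, eq_comm]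

lemma ergodicCapacity_nonneg {μ : UserGroup K → ℝ} (hμ : μ ∈ sys.ergodicCapacity)
    (J : UserGroup K) : 0 ≤ μ J := by
  obtain ⟨ν, hν, rfl⟩ := hμ
  simp only [Finset.sum_apply, Pi.smul_apply, smul_eq_mul]
  exact Finset.sum_nonneg fun s _ => mul_nonneg (sys.φ_nonneg s) ((hν s).1 J)

theorem sum_rate_le_of_mem_ergodicCapacity {μ : UserGroup K → ℝ}
    (hμ : μ ∈ sys.ergodicCapacity) (k : Fin K) :
    ∑ J : UserGroup K with k ∈ J.1, μ J ≤
      ∑ s, sys.φ s * Real.logb 2 (1 + sys.P * sys.gain s k) := by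
  obtain ⟨ν, hν, rfl⟩ := hμ
  simp only [Finset.sum_apply, Pi.smul_apply, smul_eq_mul]
  rw [Finset.sum_comm]
  refine Finset.sum_le_sum fun s _ => ?_
  rw [← Finset.mul_sum]
  exact mul_le_mul_of_nonneg_left
    (sum_rate_le_of_mem_capacityRegion (sys.gain_pos s) (hν s) k) (sys.φ_nonneg s)

theorem degrade_mem_ergodicCapacity {μ : UserGroup K → ℝ} (hμ : μ ∈ sys.ergodicCapacity)
    {w : UserGroup K → UserGroup K → ℝ} (hw : ∀ I I', 0 ≤ w I I')
    (hsub : ∀ I I', ¬ I'.1 ⊆ I.1 → w I I' = 0) (hsum : ∀ I, ∑ I', w I I' ≤ 1) :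
    (fun I' => ∑ I, w I I' * μ I) ∈ sys.ergodicCapacity := by
  obtain ⟨ν, hν, rfl⟩ := hμ
  refine ⟨fun s I' => ∑ I, w I I' * ν s I,
    fun s => degrade_mem_capacityRegion (sys.gain_pos s) (hν s) hw hsub hsum, ?_⟩
  ext I'
  simp only [Finset.sum_apply, Pi.smul_apply, smul_eq_mul, Finset.mul_sum]
  rw [Finset.sum_comm]
  refine Finset.sum_congr rfl fun s _ => Finset.sum_congr rfl fun I _ => by ring

lemma exists_rate_bound : ∃ C : ℝ, 0 ≤ C ∧ ∀ s, ∀ R ∈ capacityRegion sys.P (sys.gain s),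
    ∀ J, R J ≤ C := by
  have h1 : Bornology.IsBounded (⋃ s, capacityRegion sys.P (sys.gain s)) :=
    (isCompact_iUnion fun s => isCompact_capacityRegion (sys.gain_pos s)).isBounded
  obtain ⟨C, hC⟩ := h1.exists_norm_le
  refine ⟨max C 0, le_max_right _ _, fun s R hR J => ?_⟩
  exact (le_abs_self _).trans ((norm_le_pi_norm R J).trans
    ((hC R (Set.mem_iUnion.2 ⟨s, hR⟩)).trans (le_max_left _ _)))

theorem integrable_rates {Ω : Type*} [MeasurableSpace Ω] {prob : Measure Ω}
    [IsProbabilityMeasure prob] {h : Ω → Fin sys.numStates} {μ : Ω → UserGroup K → ℝ}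
    (hμ : Measurable μ) (hmem : ∀ ω, μ ω ∈ capacityRegion sys.P (sys.gain (h ω))) :
    Integrable μ prob := by
  obtain ⟨C, hC0, hC⟩ := sys.exists_rate_bound
  refine Integrable.of_bound (C := C) hμ.aestronglyMeasurable (ae_of_all _ fun ω => ?_)
  refine (pi_norm_le_iff_of_nonneg hC0).2 fun J => ?_
  rw [Real.norm_of_nonneg ((hmem ω).1 J)]
  exact hC _ _ (hmem ω) J

/-- The mean of rates that are feasible in the current channel state. -/
theorem integral_mem_ergodicCapacity {Ω : Type*} [MeasurableSpace Ω] {prob : Measure Ω}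
    [IsProbabilityMeasure prob] {h : Ω → Fin sys.numStates} {μ : Ω → UserGroup K → ℝ}
    (hh : Measurable h) (hlaw : ∀ s, prob (h ⁻¹' {s}) = ENNReal.ofReal (sys.φ s))
    (hμ : Measurable μ) (hmem : ∀ ω, μ ω ∈ capacityRegion sys.P (sys.gain (h ω))) :
    ∫ ω, μ ω ∂prob ∈ sys.ergodicCapacity := by
  have hint := sys.integrable_rates (prob := prob) hμ hmem
  have hms : ∀ s, MeasurableSet (h ⁻¹' {s}) := fun s => hh (measurableSet_singleton s)
  -- The witnesses are the conditional means given the channel state, which convexity and closedness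
  -- keep in the region; states of probability zero get the rate `0`.
  refine ⟨fun s => if sys.φ s = 0 then 0 else ⨍ ω in h ⁻¹' {s}, μ ω ∂prob, fun s => ?_, ?_⟩
  · simp only
    split_ifs with h0
    · exact zero_mem_capacityRegion sys.P_pos.le (sys.gain_pos s)
    · refine (convex_capacityRegion (sys.gain_pos s)).set_average_mem
        (isClosed_capacityRegion (sys.gain_pos s)) ?_ (measure_ne_top _ _) ?_ hint.integrableOn
      · rw [hlaw]
        simpa using lt_of_le_of_ne (sys.φ_nonneg s) (Ne.symm h0)
      · refine (ae_restrict_iff' (hms s)).2 (ae_of_all _ fun ω hω => ?_)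
        have : h ω = s := hω
        exact this ▸ hmem ω
  · have hU : (⋃ s, h ⁻¹' {s}) = Set.univ := by ext ω; simp
    rw [← setIntegral_univ, ← hU, integral_iUnion_fintype hms
      (fun s t hst => Disjoint.preimage h (by simpa using hst)) fun s => hint.integrableOn]
    refine Finset.sum_congr rfl fun s _ => ?_
    have hreal : prob.real (h ⁻¹' {s}) = sys.φ s := by
      rw [Measure.real, hlaw, ENNReal.toReal_ofReal (sys.φ_nonneg s)]
    beta_reduce
    split_ifs with h0
    · rw [smul_zero]
      refine setIntegral_measure_zero _ ?_
      rw [hlaw, h0, ENNReal.ofReal_zero]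
    · rw [setAverage_eq, hreal, smul_smul, mul_inv_cancel₀ h0, one_smul]

theorem average_mem_ergodicCapacity {T : ℕ} (hT : 0 < T) {μ : ℕ → UserGroup K → ℝ}
    (hμ : ∀ t, μ t ∈ sys.ergodicCapacity) :
    (T : ℝ)⁻¹ • ∑ t ∈ Finset.range T, μ t ∈ sys.ergodicCapacity := by
  rw [Finset.smul_sum]
  refine sys.convex_ergodicCapacity.sum_mem (fun _ _ => by positivity) ?_ fun t _ => hμ t
  rw [Finset.sum_const, Finset.card_range, nsmul_eq_mul, mul_inv_cancel₀ (by positivity)]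

/-- `Γcc` is closed, in the form of a limit along rates and combination frequencies that meet
the constraints approximately. -/
theorem mem_Γcc_of_approx {a : Fin K → ℝ≥0}
    (h : ∀ ε : ℝ, 0 < ε → ∃ μ ∈ sys.ergodicCapacity, ∃ σ : UserGroup K → ℝ,
      (∀ J, 0 ≤ σ J ∧ σ J ≤ sys.σmax) ∧
      (∀ k, (a k : ℝ) - ε ≤ ∑ J : UserGroup K with k ∈ J.1, σ J) ∧
      (∀ I : UserGroup K,
        ∑ J : UserGroup K with I.1 ⊆ J.1, sys.b J I * σ J - ε ≤ sys.Tslot * μ I)) :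
    a ∈ sys.Γcc := by
  choose! μ hμ σ hσ ha hb using h
  set ε : ℕ → ℝ := fun n => 1 / ((n : ℝ) + 1) with hε
  have hε0 : ∀ n, 0 < ε n := fun n => by positivity
  have hεlim : Tendsto ε atTop (𝓝 0) := tendsto_one_div_add_atTop_nhds_zero_nat
  -- Rates and frequencies range over a compact set, so the approximate solutions for the errors `ε
  -- n` have a limit point, which satisfies the constraints exactly.
  have hcpt : IsCompact (sys.ergodicCapacity ×ˢ
      (Set.univ.pi fun _ : UserGroup K => Set.Icc (0 : ℝ) sys.σmax)) :=
    sys.isCompact_ergodicCapacity.prod (isCompact_univ_pi fun _ => isCompact_Icc)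
  obtain ⟨⟨μ', σ'⟩, ⟨hm1, hm2⟩, g, hg, hlim⟩ := hcpt.tendsto_subseq
    (x := fun n => (μ (ε n), σ (ε n))) fun n => ⟨hμ _ (hε0 n), fun J _ => hσ _ (hε0 n) J⟩
  have hεg := hεlim.comp hg.tendsto_atTop
  have l1 := fun I => ((continuous_apply I).comp continuous_fst).tendsto _ |>.comp hlim
  have l2 := fun J => ((continuous_apply J).comp continuous_snd).tendsto _ |>.comp hlim
  refine ⟨μ', hm1, σ', fun J => hm2 J (Set.mem_univ J), fun k => ?_, fun I => ?_⟩
  · have i1 := hεg.const_sub (a k : ℝ)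
    rw [sub_zero] at i1
    exact le_of_tendsto_of_tendsto' i1 (tendsto_finsetSum _ fun J _ => l2 J)
      fun n => ha _ (hε0 (g n)) k
  · have i1 := (tendsto_finsetSum (Finset.univ.filter fun J : UserGroup K => I.1 ⊆ J.1)
      fun J _ => (l2 J).const_mul (sys.b J I)).sub hεg
    rw [sub_zero] at i1
    exact le_of_tendsto_of_tendsto' i1 ((l1 I).const_mul sys.Tslot)
      fun n => hb _ (hε0 (g n)) I

theorem isClosed_Γcc : IsClosed sys.Γcc := by
  refine isClosed_of_closure_subset fun a ha => sys.mem_Γcc_of_approx fun ε hε => ?_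
  have hopen : IsOpen {c : Fin K → ℝ≥0 | ∀ k, (a k : ℝ) - ε < c k} := by
    simp only [Set.ofPred_forall]
    exact isOpen_iInter_of_finite fun k => isOpen_lt continuous_const (by fun_prop)
  obtain ⟨c, hc1, μ, hμ, σ, h1, h2, h3⟩ := mem_closure_iff.1 ha _ hopen fun k => by linarith
  exact ⟨μ, hμ, σ, h1, fun k => (le_of_lt (hc1 k)).trans (h2 k), fun I => by linarith [h3 I]⟩

lemma mem_Γcc_of_le {a c : Fin K → ℝ≥0} (ha : a ∈ sys.Γcc) (hca : ∀ k, c k ≤ a k) :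
    c ∈ sys.Γcc := by
  obtain ⟨μ, hμ, σ, h1, h2, h3⟩ := ha
  exact ⟨μ, hμ, σ, h1, fun k => le_trans (NNReal.coe_le_coe.2 (hca k)) (h2 k), h3⟩

lemma exists_const_mem_Γcc : ∃ δ : ℝ≥0, 0 < δ ∧ (fun _ => δ) ∈ sys.Γcc := by
  obtain ⟨c, hc, hc0⟩ : ∃ c : ℝ, (∀ s, (fun _ => c) ∈ capacityRegion sys.P (sys.gain s)) ∧
      0 < c := by
    have h1 : ∀ᶠ δ : ℝ in 𝓝[>] 0, ∀ s, (fun _ => δ) ∈ capacityRegion sys.P (sys.gain s) :=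
      eventually_all.2 fun s => exists_const_mem_capacityRegion sys.P_pos (sys.gain_pos s)
    exact (h1.and self_mem_nhdsWithin).exists
  set B : ℝ := ∑ I : UserGroup K, ∑ J : UserGroup K, sys.b J I with hB
  have hB0 : 0 ≤ B := Finset.sum_nonneg fun I _ => Finset.sum_nonneg fun J _ => sys.b_nonneg J I
  have hT := sys.Tslot_pos
  have hσ : (0 : ℝ) < sys.σmax := by exact_mod_cast sys.σmax_pos
  -- With all frequencies equal to `η`, a codeword queue receives at most `(1 + B) * η ≤ Tslot * c`
  -- bits per slot. The `1` keeps the denominator positive, since `B = 0` when `m = 1`.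
  set η : ℝ := min sys.σmax (sys.Tslot * c / (1 + B)) with hη
  have hη0 : 0 < η := lt_min hσ (by positivity)
  refine ⟨η.toNNReal, by simpa using hη0, fun _ => c, ⟨fun _ _ => c, hc, ?_⟩, fun _ => η,
    fun _ => ⟨hη0.le, min_le_left _ _⟩, fun k => ?_, fun I => ?_⟩
  · ext J
    simp [← Finset.sum_mul, sys.φ_sum]
  · rw [Real.coe_toNNReal _ hη0.le]
    exact Finset.single_le_sum (f := fun _ : UserGroup K => η) (fun _ _ => hη0.le)
      (show (⟨{k}, by simp⟩ : UserGroup K) ∈ _ by simp)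
  · rw [← Finset.sum_mul]
    have h1 : ∑ J : UserGroup K with I.1 ⊆ J.1, sys.b J I ≤ 1 + B := by
      refine le_trans (Finset.sum_le_sum_of_subset_of_nonneg (Finset.filter_subset _ _)
        fun J _ _ => sys.b_nonneg J I) ?_
      have := Finset.single_le_sum (f := fun I => ∑ J : UserGroup K, sys.b J I)
        (fun I _ => Finset.sum_nonneg fun J _ => sys.b_nonneg J I) (Finset.mem_univ I)
      linarith
    calc _ ≤ (1 + B) * (sys.Tslot * c / (1 + B)) :=
          mul_le_mul h1 (min_le_right _ _) hη0.le (by positivity)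
      _ = sys.Tslot * c := by field_simp

/-- Mixing `a` with a positive constant vector stays in `Γcc`, and this mixture exceeds `(1 - η) *
a` strictly in every coordinate, also where `a` is zero. Downward closedness of `Γcc` supplies the
neighbourhood. -/
theorem smul_mem_interior_Γcc {a : Fin K → ℝ≥0} (ha : a ∈ sys.Γcc) {η : ℝ≥0} (h0 : 0 < η)
    (h1 : η ≤ 1) : (fun k => (1 - η) * a k) ∈ interior sys.Γcc := by
  obtain ⟨δ, hδ, μ', hμ', σ', g1, g2, g3⟩ := sys.exists_const_mem_Γcc
  obtain ⟨μ, hμ, σ, f1, f2, f3⟩ := ha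
  have hη1 : ((1 - η : ℝ≥0) : ℝ) = 1 - η := NNReal.coe_sub h1
  have h0' : (0 : ℝ) ≤ 1 - η := by rw [← hη1]; exact NNReal.coe_nonneg _
  have hz : (fun k => (1 - η) * a k + η * δ) ∈ sys.Γcc := by
    refine ⟨(1 - η : ℝ) • μ + (η : ℝ) • μ', sys.convex_ergodicCapacity hμ hμ' h0' η.2 (by ring),
      fun J => (1 - η : ℝ) * σ J + η * σ' J, fun J => ⟨?_, ?_⟩, fun k => ?_, fun I => ?_⟩
    · exact add_nonneg (mul_nonneg h0' (f1 J).1) (mul_nonneg η.2 (g1 J).1)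
    · have := mul_le_mul_of_nonneg_left (f1 J).2 h0'
      have := mul_le_mul_of_nonneg_left (g1 J).2 η.2
      simp only [NNReal.val_eq_coe] at this
      linarith
    · have i1 := mul_le_mul_of_nonneg_left (f2 k) h0'
      have i2 := mul_le_mul_of_nonneg_left (g2 k) η.2
      rw [Finset.sum_add_distrib, ← Finset.mul_sum, ← Finset.mul_sum]
      push_cast [hη1]
      exact add_le_add i1 i2
    · have i1 := mul_le_mul_of_nonneg_left (f3 I) h0'
      have i2 := mul_le_mul_of_nonneg_left (g3 I) η.2
      simp only [NNReal.val_eq_coe, Finset.mul_sum] at i1 i2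
      simp only [mul_add, Finset.sum_add_distrib, Pi.add_apply, Pi.smul_apply, smul_eq_mul]
      refine (add_le_add (le_of_eq ?_) (le_of_eq ?_)).trans
        ((add_le_add i1 i2).trans (le_of_eq ?_))
      · exact Finset.sum_congr rfl fun J _ => by ring
      · exact Finset.sum_congr rfl fun J _ => by ring
      · ring
  have hopen : IsOpen {c : Fin K → ℝ≥0 | ∀ k, c k < (1 - η) * a k + η * δ} := by
    simp only [Set.ofPred_forall]
    exact isOpen_iInter_of_finite fun k => isOpen_lt (continuous_apply k) continuous_const
  refine interior_maximal (fun c hc => sys.mem_Γcc_of_le hz fun k => (hc k).le) hopen ?_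
  intro k
  exact lt_add_of_pos_right _ (mul_pos h0 hδ)

theorem closure_interior_Γcc : closure (interior sys.Γcc) = sys.Γcc := by
  refine Set.Subset.antisymm
    (closure_minimal interior_subset sys.isClosed_Γcc) fun a ha => ?_
  have hlim : Tendsto (fun n : ℕ => fun k => (1 - (1 / ((n : ℝ≥0) + 1))) * a k) atTop (𝓝 a) := by
    refine tendsto_pi_nhds.2 fun k => ?_
    have : Tendsto (fun n : ℕ => 1 / ((n : ℝ≥0) + 1)) atTop (𝓝 0) := by
      rw [← NNReal.tendsto_coe]
      simpa using tendsto_one_div_add_atTop_nhds_zero_nat (𝕜 := ℝ)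
    simpa using ((tendsto_const_nhds (x := (1 : ℝ≥0))).sub this).mul_const (a k)
  refine mem_closure_of_tendsto hlim (Eventually.of_forall fun n => ?_)
  refine sys.smul_mem_interior_Γcc ha (by positivity) ?_
  rw [div_le_one (by positivity)]
  simp

theorem isCompact_Γcc : IsCompact sys.Γcc := by
  refine (isCompact_univ_pi fun _ : Fin K =>
    isCompact_Icc (a := (0 : ℝ≥0)) (b := ∑ _J : UserGroup K, (sys.σmax : ℝ≥0))).of_isClosed_subset
    sys.isClosed_Γcc ?_
  rintro a ⟨μ, hμ, σ, h1, h2, h3⟩ k -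
  refine ⟨zero_le, ?_⟩
  rw [← NNReal.coe_le_coe]
  push_cast
  refine (h2 k).trans ((Finset.sum_le_sum_of_subset_of_nonneg (Finset.filter_subset _ _)
    fun J _ _ => (h1 J).1).trans (Finset.sum_le_sum fun J _ => (h1 J).2))

/-- A rate vector in the interior of `Γcc` can be served with slack. -/
theorem exists_slack_of_mem_interior {a : Fin K → ℝ≥0} (ha : a ∈ interior sys.Γcc) :
    ∃ ν : Fin sys.numStates → UserGroup K → ℝ,
      (∀ s, ν s ∈ capacityRegion sys.P (sys.gain s)) ∧ ∃ σ : UserGroup K → ℝ,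
      (∀ J, 0 ≤ σ J ∧ σ J ≤ sys.σmax) ∧
      (∀ k, (a k : ℝ) < ∑ J : UserGroup K with k ∈ J.1, σ J) ∧
      (∀ I : UserGroup K, (∀ J : UserGroup K, I.1 ⊆ J.1 → sys.b J I * σ J = 0) ∨
        ∑ J : UserGroup K with I.1 ⊆ J.1, sys.b J I * σ J <
          sys.Tslot * ∑ s, sys.φ s * ν s I) := by
  have hc : Continuous fun δ : ℝ≥0 => fun k => a k + δ := by fun_prop
  have h1 : ∀ᶠ δ in 𝓝[>] (0 : ℝ≥0), (fun k => a k + δ) ∈ sys.Γcc := by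
    refine nhdsWithin_le_nhds ?_
    have := hc.tendsto 0
    simp only [add_zero] at this
    exact (this.eventually (isOpen_interior.mem_nhds ha)).mono fun _ h => interior_subset h
  obtain ⟨δ, ⟨μ, ⟨ν, hν, rfl⟩, σ, f1, f2, f3⟩, hδ⟩ := (h1.and self_mem_nhdsWithin).exists
  have hδ : (0 : ℝ) < δ := by exact_mod_cast hδ
  -- The interior gives room `δ` above `a`; part of it is traded for slack in the channel
  -- constraints by shrinking all frequencies by the factor `1 - η`.
  obtain ⟨η, hη0, hη1, hη⟩ : ∃ η : ℝ, 0 < η ∧ η < 1 ∧ ∀ k, (a k : ℝ) < (1 - η) * (a k + δ) := by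
    have h2 : ∀ᶠ η in 𝓝[>] (0 : ℝ), ∀ k, (a k : ℝ) < (1 - η) * (a k + δ) := by
      refine eventually_all.2 fun k => nhdsWithin_le_nhds ?_
      have hc : Continuous fun η : ℝ => (1 - η) * ((a k : ℝ) + δ) := by fun_prop
      refine (hc.tendsto 0).eventually (lt_mem_nhds ?_)
      simpa using hδ
    obtain ⟨η, ⟨g1, g2⟩, g3⟩ := ((h2.and (nhdsWithin_le_nhds (gt_mem_nhds one_pos))).and
      self_mem_nhdsWithin).exists
    exact ⟨η, g3, g2, g1⟩
  refine ⟨ν, hν, fun J => (1 - η) * σ J, fun J => ⟨?_, ?_⟩, fun k => ?_, fun I => ?_⟩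
  · exact mul_nonneg (by linarith) (f1 J).1
  · exact (mul_le_of_le_one_left (f1 J).1 (by linarith)).trans (f1 J).2
  · rw [← Finset.mul_sum]
    have h3 := f2 k
    push_cast at h3
    exact (hη k).trans_le (mul_le_mul_of_nonneg_left h3 (by linarith))
  · have hpos : ∀ J ∈ (Finset.univ.filter fun J : UserGroup K => I.1 ⊆ J.1),
        0 ≤ sys.b J I * σ J := fun J _ => mul_nonneg (sys.b_nonneg J I) (f1 J).1
    have e : ∑ J : UserGroup K with I.1 ⊆ J.1, sys.b J I * ((1 - η) * σ J) =
        (1 - η) * ∑ J : UserGroup K with I.1 ⊆ J.1, sys.b J I * σ J := by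
      rw [Finset.mul_sum]
      exact Finset.sum_congr rfl fun J _ => by ring
    have h4 := f3 I
    simp only [Finset.sum_apply, Pi.smul_apply, smul_eq_mul] at h4
    -- Shrinking gains nothing when the load of `I` is zero, but the queue then receives no bits;
    -- hence the alternative in the conclusion.
    rcases (Finset.sum_nonneg hpos).eq_or_lt with h0 | h0
    · left
      intro J hJ
      have := (Finset.sum_eq_zero_iff_of_nonneg hpos).1 h0.symm J (by simpa using hJ)
      linear_combination (1 - η) * this
    · right
      rw [e]
      nlinarith

end CachingSystem

/-! ### Utility on sets between the interior and the closure of a region -/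

lemma continuous_totalUtility {K : ℕ} {α d : Fin K → ℝ} (hd : ∀ k, 0 < d k) :
    Continuous (totalUtility α d) := by
  unfold totalUtility
  refine continuous_finsetSum _ fun k _ => ?_
  unfold alphaFair
  have hc : Continuous fun r : Fin K → ℝ≥0 => (r k : ℝ) := by fun_prop
  have hdk := hd k
  split_ifs with h
  · refine Continuous.log (by fun_prop) fun r => ?_
    have := (r k).2
    positivity
  · refine (Continuous.rpow_const (by fun_prop) fun r => Or.inl ?_).div_const _
    have : (0 : ℝ) ≤ r k := (r k).2
    positivity

/-- A continuous function has the same supremum and the same limiting maximizers on all sets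
between the interior and the closure of a regular compact set. -/
theorem isLUB_of_interior_subset {X : Type*} [TopologicalSpace X] {Γ : Set X} (hΓ : IsCompact Γ)
    (hne : Γ.Nonempty) (hreg : closure (interior Γ) = Γ) {u : X → ℝ} (hu : Continuous u) :
    ∃ v : ℝ, (∃ r ∈ Γ, u r = v) ∧
      ∀ A : Set X, interior Γ ⊆ A → A ⊆ Γ → closure A = Γ ∧ IsLUB (u '' A) v := by
  obtain ⟨r, hr, hmax⟩ := hΓ.exists_isMaxOn hne hu.continuousOn
  refine ⟨u r, ⟨r, hr, rfl⟩, fun A h1 h2 => ?_⟩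
  have hcl : closure A = Γ := by
    refine Set.Subset.antisymm ?_ (hreg.symm.subset.trans (closure_mono h1))
    refine (closure_mono h2).trans ?_
    rw [← hreg, closure_closure]
  refine ⟨hcl, ?_, fun c hc => ?_⟩
  · rintro _ ⟨a, ha, rfl⟩
    exact hmax (h2 ha)
  · have : closure A ⊆ {x | u x ≤ c} :=
      closure_minimal (fun a ha => hc ⟨a, ha, rfl⟩) (isClosed_le hu continuous_const)
    rw [hcl] at this
    exact this hr

/-! ### Queues -/

lemma sum_le_userBacklog_add (a c : ℕ → ℕ) (t : ℕ) :
    ∑ s ∈ Finset.range t, a s ≤ userBacklog a c t + ∑ s ∈ Finset.range t, c s := by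
  induction t with
  | zero => simp
  | succ t ih =>
    rw [Finset.sum_range_succ, Finset.sum_range_succ, userBacklog]
    omega

/-- Conservation of files: the `min` of backlog and demand is what actually leaves the queue. -/
lemma sum_min_add_userBacklog (a c : ℕ → ℕ) (t : ℕ) :
    ∑ s ∈ Finset.range t, min (userBacklog a c s) (c s) + userBacklog a c t =
      ∑ s ∈ Finset.range t, a s := by
  induction t with
  | zero => simp [userBacklog]
  | succ t ih =>
    rw [Finset.sum_range_succ, Finset.sum_range_succ, userBacklog]
    omega

section
variable {arr srv : ℕ → ℝ}

lemma codewordBacklog_nonneg (ha : ∀ t, 0 ≤ arr t) (t : ℕ) : 0 ≤ codewordBacklog arr srv t := by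
  cases t with
  | zero => exact le_rfl
  | succ t => exact add_nonneg (le_max_right _ _) (ha t)

lemma codewordBacklog_le_sum (ha : ∀ t, 0 ≤ arr t) (hs : ∀ t, 0 ≤ srv t) (t : ℕ) :
    codewordBacklog arr srv t ≤ ∑ s ∈ Finset.range t, arr s := by
  induction t with
  | zero => simp [codewordBacklog]
  | succ t ih =>
    rw [Finset.sum_range_succ, codewordBacklog]
    have h1 := codewordBacklog_nonneg (srv := srv) ha t
    have := max_le (sub_le_self _ (hs t)) h1
    linarith

/-- Offered service may be wasted on an empty queue, so only an inequality holds. -/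
lemma sum_sub_sum_le_codewordBacklog (t : ℕ) :
    ∑ s ∈ Finset.range t, arr s - ∑ s ∈ Finset.range t, srv s ≤ codewordBacklog arr srv t := by
  induction t with
  | zero => simp [codewordBacklog]
  | succ t ih =>
    rw [Finset.sum_range_succ, Finset.sum_range_succ, codewordBacklog]
    have := le_max_left (codewordBacklog arr srv t - srv t) 0
    linarith

end

lemma measurable_codewordBacklog {Ω : Type*} {mΩ : MeasurableSpace Ω} {arr srv : ℕ → Ω → ℝ}
    (t : ℕ) (ha : ∀ s < t, Measurable (arr s)) (hs : ∀ s < t, Measurable (srv s)) :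
    Measurable fun ω => codewordBacklog (fun s => arr s ω) (fun s => srv s ω) t := by
  induction t with
  | zero => exact measurable_const
  | succ t ih =>
    have h1 := ih (fun s hst => ha s (by omega)) fun s hst => hs s (by omega)
    exact ((h1.sub (hs t (by omega))).max measurable_const).add (ha t (by omega))

lemma measurable_userBacklog {Ω : Type*} {mΩ : MeasurableSpace Ω} {a c : ℕ → Ω → ℕ}
    (t : ℕ) (ha : ∀ s < t, Measurable (a s)) (hc : ∀ s < t, Measurable (c s)) :
    Measurable fun ω => userBacklog (fun s => a s ω) (fun s => c s ω) t := by
  induction t with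
  | zero => exact measurable_const
  | succ t ih =>
    have h1 := ih (fun s hst => ha s (by omega)) fun s hst => hc s (by omega)
    exact (h1.sub (hc t (by omega))).add (ha t (by omega))

/-! ### Measurability and bookkeeping for an arbitrary scheme -/

namespace CachingSystem.Scheme

variable {K : ℕ} {sys : CachingSystem K} (π : Scheme sys)

lemma measurable_a (t : ℕ) (k : Fin K) : Measurable fun ω => π.a t ω k :=
  (measurable_pi_iff.1 ((π.a_adapted t).mono (π.ℱ.le t) le_rfl)) k

lemma measurable_σ (t : ℕ) (J : UserGroup K) : Measurable fun ω => π.σ t ω J :=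
  (measurable_pi_iff.1 ((π.σ_adapted t).mono (π.ℱ.le t) le_rfl)) J

lemma measurable_x (t : ℕ) (k : Fin K) (J : UserGroup K) : Measurable fun ω => π.x t ω k J :=
  measurable_pi_iff.1 (measurable_pi_iff.1 ((π.x_adapted t).mono (π.ℱ.le t) le_rfl) k) J

lemma measurable_μ (t : ℕ) : Measurable (π.μ t) :=
  (π.μ_adapted t).mono (π.ℱ.le t) le_rfl

lemma measurable_h (t : ℕ) : Measurable (π.h t) :=
  (π.h_adapted t).mono (π.ℱ.le t) le_rfl

lemma measurable_rate (t : ℕ) (I : UserGroup K) : Measurable fun ω => π.μ t ω I :=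
  measurable_pi_iff.1 (π.measurable_μ t) I

lemma measurable_arrivals (I : UserGroup K) (t : ℕ) : Measurable (π.arrivals I t) := by
  unfold arrivals
  refine Finset.measurable_sum _ fun J _ => measurable_const.mul ?_
  exact measurable_from_top.comp (π.measurable_σ t J)

lemma measurable_created (I : UserGroup K) (t : ℕ) : Measurable (π.created I t) :=
  Finset.measurable_sum _ fun s _ => π.measurable_arrivals I s

lemma measurable_Q (I : UserGroup K) (t : ℕ) : Measurable (π.Q I t) :=
  measurable_codewordBacklog t (fun s _ => π.measurable_arrivals I s)
    fun s _ => measurable_const.mul (π.measurable_rate s I)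

lemma measurable_S (k : Fin K) (t : ℕ) : Measurable (π.S k t) :=
  measurable_userBacklog t (fun s _ => π.measurable_a s k)
    fun s _ => Finset.measurable_sum _ fun J _ => π.measurable_σ s J

lemma measurableSet_transmitted (I : UserGroup K) (s t : ℕ) :
    MeasurableSet {ω | π.Transmitted I s t ω} :=
  measurableSet_le (π.measurable_created I _)
    ((π.measurable_created I t).sub (π.measurable_Q I t))

lemma rate_nonneg (t : ℕ) (ω : π.Ω) (I : UserGroup K) : 0 ≤ π.μ t ω I :=
  (π.μ_mem t ω).1 I

lemma arrivals_nonneg (I : UserGroup K) (t : ℕ) (ω : π.Ω) : 0 ≤ π.arrivals I t ω :=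
  Finset.sum_nonneg fun J _ => mul_nonneg (sys.b_nonneg J I) (Nat.cast_nonneg _)

lemma service_nonneg (I : UserGroup K) (t : ℕ) (ω : π.Ω) : 0 ≤ sys.Tslot * π.μ t ω I :=
  mul_nonneg sys.Tslot_pos.le (π.rate_nonneg t ω I)

lemma Q_nonneg (I : UserGroup K) (t : ℕ) (ω : π.Ω) : 0 ≤ π.Q I t ω :=
  codewordBacklog_nonneg (fun s => π.arrivals_nonneg I s ω) t

lemma sent_nonneg (I : UserGroup K) (t : ℕ) (ω : π.Ω) : 0 ≤ π.sent I t ω :=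
  sub_nonneg.2 (codewordBacklog_le_sum (fun s => π.arrivals_nonneg I s ω)
    (fun s => π.service_nonneg I s ω) t)

lemma sent_le (I : UserGroup K) (t : ℕ) (ω : π.Ω) :
    π.sent I t ω ≤ sys.Tslot * ∑ s ∈ Finset.range t, π.μ s ω I := by
  have := sum_sub_sum_le_codewordBacklog (arr := fun s => π.arrivals I s ω)
    (srv := fun s => sys.Tslot * π.μ s ω I) t
  rw [← Finset.mul_sum] at this
  unfold sent created Q
  linarith

open Classical in
/-- The codewords that have been multicast fit into the service. -/
lemma sum_transmitted_le (I : UserGroup K) (t : ℕ) (ω : π.Ω) :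
    ∑ s ∈ Finset.range t with π.Transmitted I s t ω, π.arrivals I s ω ≤
      sys.Tslot * ∑ s ∈ Finset.range t, π.μ s ω I := by
  refine le_trans ?_ (π.sent_le I t ω)
  rcases (Finset.filter (fun s => π.Transmitted I s t ω) (Finset.range t)).eq_empty_or_nonempty
    with h | h
  · rw [h, Finset.sum_empty]
    exact π.sent_nonneg I t ω
  -- By the first-in-first-out rule the latest transmitted slot decides: all that was created up to
  -- it has been sent.
  · have h1 := Finset.max'_mem _ h
    refine le_trans ?_ (Finset.mem_filter.1 h1).2
    refine Finset.sum_le_sum_of_subset_of_nonneg (fun s hs => ?_)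
      fun s _ _ => π.arrivals_nonneg I s ω
    exact Finset.mem_range_succ_iff.2 (Finset.le_max' _ s hs)

lemma x_le_σmax (t : ℕ) (ω : π.Ω) (k : Fin K) (J : UserGroup K) : π.x t ω k J ≤ sys.σmax := by
  refine (π.x_le t ω k J).trans ?_
  split_ifs
  · exact π.σ_le t ω J
  · exact Nat.zero_le _

/-- Mean of the rates before slot `T`, averaged over the slots. -/
def meanRate (T : ℕ) : UserGroup K → ℝ :=
  (T : ℝ)⁻¹ • ∑ t ∈ Finset.range T, ∫ ω, π.μ t ω ∂π.prob

lemma meanRate_mem {T : ℕ} (hT : 0 < T) : π.meanRate T ∈ sys.ergodicCapacity :=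
  sys.average_mem_ergodicCapacity hT fun t =>
    sys.integral_mem_ergodicCapacity (π.measurable_h t) (π.h_law t) (π.measurable_μ t) (π.μ_mem t)

lemma integrable_rate (t : ℕ) (I : UserGroup K) : Integrable (fun ω => π.μ t ω I) π.prob :=
  (sys.integrable_rates (prob := π.prob) (π.measurable_μ t) (π.μ_mem t)).eval I

lemma integral_sum_rate {T : ℕ} (hT : 0 < T) (I : UserGroup K) :
    ∫ ω, sys.Tslot * ∑ t ∈ Finset.range T, π.μ t ω I ∂π.prob =
      T * (sys.Tslot * π.meanRate T I) := by
  rw [integral_const_mul, integral_finsetSum _ fun t _ => π.integrable_rate t I]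
  have : ∀ t, ∫ ω, π.μ t ω I ∂π.prob = (∫ ω, π.μ t ω ∂π.prob) I := fun t =>
    (eval_integral (fun J => π.integrable_rate t J) I).symm
  simp only [this, meanRate, Pi.smul_apply, Finset.sum_apply, smul_eq_mul]
  have : (T : ℝ) ≠ 0 := by positivity
  field_simp

lemma integrable_sum_rate (T : ℕ) (I : UserGroup K) :
    Integrable (fun ω => sys.Tslot * ∑ t ∈ Finset.range T, π.μ t ω I) π.prob :=
  (integrable_finsetSum _ fun t _ => π.integrable_rate t I).const_mul _

end CachingSystem.Scheme

/-- A lower bound for a time-dependent quantity that holds almost surely in the limit passes to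
the means. -/
lemma eventually_le_integral {Ω : Type*} [MeasurableSpace Ω] {prob : Measure Ω}
    [IsProbabilityMeasure prob] {X : ℕ → Ω → ℝ} (hX : ∀ t, Integrable (X t) prob)
    (hX0 : ∀ t ω, 0 ≤ X t ω) {r : ℝ} (hr : 0 ≤ r)
    (hlim : ∀ᵐ ω ∂prob, ∀ ε : ℝ, 0 < ε → ∀ᶠ t in atTop, r - ε ≤ X t ω) {ε : ℝ} (hε : 0 < ε) :
    ∀ᶠ t in atTop, r - ε ≤ ∫ ω, X t ω ∂prob := by
  -- Truncation at `r` provides the dominating constant, and the truncated variables converge to `r`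
  -- almost surely.
  have hint : ∀ t, Integrable (fun ω => min (X t ω) r) prob := fun t =>
    (hX t).inf (integrable_const r)
  have h1 : Tendsto (fun t => ∫ ω, min (X t ω) r ∂prob) atTop (𝓝 (∫ _, r ∂prob)) := by
    refine tendsto_integral_of_dominated_convergence (fun _ => r)
      (fun t => (hint t).aestronglyMeasurable) (integrable_const r)
      (fun t => ae_of_all _ fun ω => ?_) ?_
    · rw [Real.norm_of_nonneg (le_min (hX0 t ω) hr)]
      exact min_le_right _ _
    · filter_upwards [hlim] with ω hω
      rw [Metric.tendsto_atTop']
      intro δ hδ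
      obtain ⟨N, hN⟩ := eventually_atTop.1 (hω (δ / 2) (by positivity))
      refine ⟨N, fun t ht => ?_⟩
      have h2 := hN t ht.le
      rw [Real.dist_eq, abs_lt]
      have h3 : r - δ / 2 ≤ min (X t ω) r := le_min h2 (by linarith)
      have h4 := min_le_right (X t ω) r
      constructor <;> linarith
  simp only [integral_const, probReal_univ, smul_eq_mul, one_mul] at h1
  filter_upwards [h1.eventually (lt_mem_nhds (show r - ε < r by linarith))] with t ht
  exact ht.le.trans (integral_mono (hint t) (hX t) fun ω => min_le_left _ _)

/-! ### Regrouping of abandoned combinations -/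

namespace CachingSystem

variable {K : ℕ} (sys : CachingSystem K)

/-- The codewords for the sets that meet `U` in `I` are as long as the codeword for `I` when only
files of the users in `U` are combined. -/
theorem sum_b_inter_eq {J U I : UserGroup K} (hUJ : U.1 ⊆ J.1) (hIU : I.1 ⊆ U.1) :
    ∑ I' : UserGroup K with I'.1 ⊆ J.1 ∧ U.1 ∩ I'.1 = I.1, sys.b J I' = sys.b U I := by
  have hIJ := hIU.trans hUJ
  have hcardI := Finset.card_le_card hIU
  have hcardU := Finset.card_le_card hUJ
  have hI1 := Finset.card_pos.2 I.2
  have hdisj : ∀ A ⊆ J.1 \ U.1, Disjoint I.1 A := fun A hA =>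
    Finset.disjoint_left.2 fun k hk hkA => (Finset.mem_sdiff.1 (hA hkA)).2 (hIU hk)
  have hX : (J.1 \ U.1).card = J.1.card - U.1.card := Finset.card_sdiff_of_subset hUJ
  -- The sets `I'` are the unions `I ∪ A` with arbitrary `A ⊆ J \ U`; their lengths add up by the
  -- binomial theorem for `m + (1 - m) = 1`.
  have key : ∑ I' : UserGroup K with I'.1 ⊆ J.1 ∧ U.1 ∩ I'.1 = I.1, sys.b J I' =
      ∑ A ∈ (J.1 \ U.1).powerset, sys.b U I *
        (sys.m ^ A.card * (1 - sys.m) ^ ((J.1 \ U.1).card - A.card)) := by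
    refine (Finset.sum_bij (fun A _ => (⟨I.1 ∪ A, I.2.mono Finset.subset_union_left⟩ :
      UserGroup K)) ?_ ?_ ?_ ?_).symm
    · intro A hA
      rw [Finset.mem_powerset] at hA
      simp only [Finset.mem_filter, Finset.mem_univ, true_and]
      refine ⟨Finset.union_subset hIJ (hA.trans Finset.sdiff_subset), ?_⟩
      rw [Finset.inter_union_distrib_left, Finset.inter_eq_right.2 hIU,
        Finset.union_eq_left.2]
      intro k hk
      rw [Finset.mem_inter] at hk
      exact absurd hk.1 (Finset.mem_sdiff.1 (hA hk.2)).2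
    · intro A hA B hB hAB
      rw [Finset.mem_powerset] at hA hB
      have h : I.1 ∪ A = I.1 ∪ B := congrArg Subtype.val hAB
      rw [← Finset.union_sdiff_cancel_left (hdisj A hA), h,
        Finset.union_sdiff_cancel_left (hdisj B hB)]
    · intro I' hI'
      obtain ⟨h1, h2⟩ := (Finset.mem_filter.1 hI').2
      refine ⟨I'.1 \ U.1, Finset.mem_powerset.2 (Finset.sdiff_subset_sdiff h1 le_rfl), ?_⟩
      apply Subtype.ext
      simp only
      rw [← h2, Finset.inter_comm, Finset.union_comm, Finset.sdiff_union_inter]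
    · intro A hA
      rw [Finset.mem_powerset] at hA
      have hcA := Finset.card_le_card hA
      simp only [b, Finset.card_union_of_disjoint (hdisj A hA)]
      -- The truncated subtractions are genuine because `I` is nonempty, `I ⊆ U ⊆ J` and `A ⊆ J \
      -- U`.
      have e1 : I.1.card + A.card - 1 = (I.1.card - 1) + A.card := by omega
      have e2 : J.1.card - (I.1.card + A.card) + 1 =
          (U.1.card - I.1.card + 1) + ((J.1 \ U.1).card - A.card) := by omega
      rw [e1, e2, pow_add, pow_add]
      ring
  rw [key, ← Finset.mul_sum, Finset.sum_pow_mul_eq_add_pow, add_sub_cancel, one_pow, mul_one]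

/-- A file of a user in `U` takes `(1 - m) F` bits to deliver. -/
lemma sum_b_user_eq {U : UserGroup K} {k : Fin K} (hk : k ∈ U.1) :
    ∑ I : UserGroup K with I.1 ⊆ U.1 ∧ k ∈ I.1, sys.b U I = (1 - sys.m) * sys.F := by
  -- Regrouping for the single user `k`, who alone needs a codeword of `(1 - m) * F` bits.
  have := sys.sum_b_inter_eq (J := U) (U := ⟨{k}, by simp⟩) (I := ⟨{k}, by simp⟩)
    (by simpa using hk) subset_rfl
  simpa [b] using this

/-- `N J U` stands for the frequency of combinations for `J` that benefit exactly the users in `U`.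
To them the codeword for `I'` is worth one for `U ∩ I'`, so degrading the rate of `I'` to subgroups
supports the same frequencies, recounted as combinations for `U`. -/
theorem exists_regrouped_rates {μ : UserGroup K → ℝ} (hμ : μ ∈ sys.ergodicCapacity)
    {N : UserGroup K → UserGroup K → ℝ} (hN : ∀ J U, 0 ≤ N J U)
    (hsub : ∀ J U, ¬ U.1 ⊆ J.1 → N J U = 0)
    (hb : ∀ I : UserGroup K, ∑ J : UserGroup K with I.1 ⊆ J.1,
      ∑ U : UserGroup K with (U.1 ∩ I.1).Nonempty, sys.b J I * N J U ≤ sys.Tslot * μ I) :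
    ∃ μ' ∈ sys.ergodicCapacity, ∀ I : UserGroup K,
      ∑ U : UserGroup K with I.1 ⊆ U.1, sys.b U I * ∑ J, N J U ≤ sys.Tslot * μ' I := by
  have hT := sys.Tslot_pos
  have hμ0 := fun I => sys.ergodicCapacity_nonneg hμ I
  -- Bits per slot in codewords for `I'` that act as codewords for `I`.
  set f : UserGroup K → UserGroup K → ℝ := fun I' I =>
    ∑ J : UserGroup K, ∑ U : UserGroup K,
      if I'.1 ⊆ J.1 ∧ U.1 ∩ I'.1 = I.1 then sys.b J I' * N J U else 0 with hf
  have hterm : ∀ I' I J U : UserGroup K,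
      0 ≤ if I'.1 ⊆ J.1 ∧ U.1 ∩ I'.1 = I.1 then sys.b J I' * N J U else 0 := fun I' I J U => by
    split_ifs
    · exact mul_nonneg (sys.b_nonneg _ _) (hN _ _)
    · exact le_rfl
  have hf0 : ∀ I' I, 0 ≤ f I' I := fun I' I =>
    Finset.sum_nonneg fun J _ => Finset.sum_nonneg fun U _ => hterm I' I J U
  have hfsum : ∀ I', ∑ I, f I' I ≤ sys.Tslot * μ I' := by
    intro I'
    refine le_trans (le_of_eq ?_) (hb I')
    simp only [hf]
    rw [Finset.sum_comm, Finset.sum_filter]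
    refine Finset.sum_congr rfl fun J _ => ?_
    rw [Finset.sum_comm, Finset.sum_filter]
    split_ifs with hIJ
    · refine Finset.sum_congr rfl fun U _ => ?_
      split_ifs with hU
      · rw [Finset.sum_eq_single ⟨U.1 ∩ I'.1, hU⟩]
        · simp [hIJ]
        · intro I _ hne
          rw [if_neg]
          rintro ⟨-, h⟩
          exact hne (Subtype.ext h.symm)
        · simp
      · refine Finset.sum_eq_zero fun I _ => if_neg ?_
        rintro ⟨-, h⟩
        exact hU (h ▸ I.2)
    · refine Finset.sum_eq_zero fun U _ => Finset.sum_eq_zero fun I _ => if_neg fun h => hIJ h.1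
  refine ⟨_, sys.degrade_mem_ergodicCapacity hμ (w := fun I' I => f I' I / (sys.Tslot * μ I'))
    (fun I' I => div_nonneg (hf0 _ _) (mul_nonneg hT.le (hμ0 _))) (fun I' I hI => ?_)
    (fun I' => ?_), fun I => ?_⟩
  · have : f I' I = 0 := by
      refine Finset.sum_eq_zero fun J _ => Finset.sum_eq_zero fun U _ => if_neg ?_
      rintro ⟨-, h⟩
      exact hI (h ▸ Finset.inter_subset_right)
    rw [this, zero_div]
  · rw [← Finset.sum_div]
    exact div_le_one_of_le₀ (hfsum I') (mul_nonneg hT.le (hμ0 _))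
  -- When `μ I' = 0` the quotient is `0` by convention; this is harmless, since `f I' I` is then `0`
  -- too.
  · have e : ∀ I', f I' I / (sys.Tslot * μ I') * μ I' = f I' I / sys.Tslot := by
      intro I'
      rcases eq_or_ne (μ I') 0 with h0 | h0
      · have h1 := (Finset.single_le_sum (f := fun I => f I' I) (fun I _ => hf0 I' I)
          (Finset.mem_univ I)).trans (hfsum I')
        rw [h0, mul_zero] at h1
        have : f I' I = 0 := le_antisymm h1 (hf0 I' I)
        simp [this]
      · field_simp
    simp only [e]
    rw [← Finset.sum_div, mul_div_cancel₀ _ hT.ne']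
    simp only [hf]
    rw [Finset.sum_comm, Finset.sum_filter]
    simp only [Finset.mul_sum]
    have : ∀ U : UserGroup K, (if I.1 ⊆ U.1 then ∑ J, sys.b U I * N J U else 0) =
        ∑ J, if I.1 ⊆ U.1 then sys.b U I * N J U else 0 := fun U => by
      split_ifs <;> simp
    simp only [this]
    rw [Finset.sum_comm]
    refine Finset.sum_le_sum fun J _ => ?_
    rw [Finset.sum_comm]
    refine Finset.sum_le_sum fun U _ => ?_
    split_ifs with hIU
    · by_cases hUJ : U.1 ⊆ J.1
      · rw [← sys.sum_b_inter_eq hUJ hIU, Finset.sum_mul, Finset.sum_filter]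
      · simp [hsub J U hUJ]
    · exact Finset.sum_nonneg fun I' _ => hterm I' I J U

/-- If `σmax` files per slot exceed the single-user capacities, combination frequencies that are
supported by the channel respect the bound `σmax`. -/
theorem frequency_le_σmax
    (hcap : ∀ k, sys.Tslot * ∑ s, sys.φ s * Real.logb 2 (1 + sys.P * sys.gain s k) ≤
      (1 - sys.m) * sys.F * sys.σmax)
    {μ : UserGroup K → ℝ} (hμ : μ ∈ sys.ergodicCapacity) {σ : UserGroup K → ℝ}
    (hσ : ∀ U, 0 ≤ σ U) (hb : ∀ I : UserGroup K,
      ∑ U : UserGroup K with I.1 ⊆ U.1, sys.b U I * σ U ≤ sys.Tslot * μ I) (U : UserGroup K) :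
    σ U ≤ sys.σmax := by
  obtain ⟨k, hk⟩ := U.2
  have hT := sys.Tslot_pos
  have hlog : ∀ s, 0 < Real.logb 2 (1 + sys.P * sys.gain s k) := fun s =>
    Real.logb_pos (by norm_num) (by have := mul_pos sys.P_pos (sys.gain_pos s k); linarith)
  have hφ : ∃ s, sys.φ s ≠ 0 := by
    by_contra! h
    simpa [h] using sys.φ_sum
  obtain ⟨s0, hs0⟩ := hφ
  have hpos : 0 < ∑ s, sys.φ s * Real.logb 2 (1 + sys.P * sys.gain s k) :=
    Finset.sum_pos' (fun s _ => mul_nonneg (sys.φ_nonneg s) (hlog s).le)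
      ⟨s0, Finset.mem_univ _, mul_pos (lt_of_le_of_ne (sys.φ_nonneg s0) hs0.symm) (hlog s0)⟩
  -- Single-user capacities are positive, so `hcap` rules out `m = 1`.
  have hm : 0 < (1 - sys.m) * sys.F := by
    have h1 := (mul_pos hT hpos).trans_le (hcap k)
    exact pos_of_mul_pos_left h1 (Nat.cast_nonneg _)
  -- Each combination for `U` puts `(1 - m) * F` bits into the queues of sets containing `k`, and
  -- their total rate is at most the single-user capacity.
  have h1 : (1 - sys.m) * sys.F * σ U ≤
      ∑ I : UserGroup K with k ∈ I.1, sys.Tslot * μ I := by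
    refine le_trans ?_ (Finset.sum_le_sum fun I _ => hb I)
    rw [← sys.sum_b_user_eq hk, Finset.sum_mul, Finset.sum_filter, Finset.sum_filter]
    refine Finset.sum_le_sum fun I _ => ?_
    have hnn : ∀ V ∈ Finset.univ.filter (fun V : UserGroup K => I.1 ⊆ V.1),
        0 ≤ sys.b V I * σ V := fun V _ => mul_nonneg (sys.b_nonneg _ _) (hσ V)
    split_ifs with h h' h'
    · exact Finset.single_le_sum (f := fun V => sys.b V I * σ V) hnn (by simpa using h.1)
    · exact absurd h.2 h'
    · exact Finset.sum_nonneg hnn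
    · exact le_rfl
  have h2 := (sys.sum_rate_le_of_mem_ergodicCapacity hμ k)
  rw [← Finset.mul_sum] at h1
  have h3 := h1.trans ((mul_le_mul_of_nonneg_left h2 hT.le).trans (hcap k))
  exact le_of_mul_le_mul_left h3 hm

end CachingSystem

/-! ### Delivery rates lie in `Γcc` -/

lemma eventually_sub_le_of_liminf {D : ℕ → ℕ} {r : ℝ≥0}
    (h : liminf (fun t : ℕ => (D t : ℝ≥0∞) / (t : ℝ≥0∞)) atTop = (r : ℝ≥0∞)) {ε : ℝ}
    (hε : 0 < ε) : ∀ᶠ t : ℕ in atTop, (r : ℝ) - ε ≤ (D t : ℝ) / t := by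
  rcases lt_or_ge ((r : ℝ) - ε) 0 with h0 | h0
  · exact Eventually.of_forall fun t => h0.le.trans (by positivity)
  have h1 : ENNReal.ofReal ((r : ℝ) - ε) <
      liminf (fun t : ℕ => (D t : ℝ≥0∞) / (t : ℝ≥0∞)) atTop := by
    rw [h, ← ENNReal.ofReal_coe_nnreal, ENNReal.ofReal_lt_ofReal_iff_of_nonneg h0]
    linarith
  filter_upwards [eventually_lt_of_lt_liminf h1, eventually_gt_atTop 0] with t ht ht0
  have h2 : (0 : ℝ) < t := by exact_mod_cast ht0
  rw [← ENNReal.ofReal_natCast, ← ENNReal.ofReal_natCast, ← ENNReal.ofReal_div_of_pos h2,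
    ENNReal.ofReal_lt_ofReal_iff_of_nonneg h0] at ht
  exact ht.le

namespace CachingSystem.Scheme

variable {K : ℕ} {sys : CachingSystem K} (π : Scheme sys)

/-- Delivery rates are in `Γcc` when, for each time `t`, every combination `(s, J)` is credited to
a set `U t s J` of users for whom all codewords have been multicast, and the frequencies of the
credited sets cannot exceed `σmax`. -/
theorem mem_Γcc_of_credited (U : ℕ → ℕ → UserGroup K → π.Ω → Finset (Fin K))
    (hmeas : ∀ t s J V, MeasurableSet {ω | U t s J ω = V})
    (hsub : ∀ t s J ω, U t s J ω ⊆ J.1)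
    (htr : ∀ t s J ω (I : UserGroup K), I.1 ⊆ J.1 → (U t s J ω ∩ I.1).Nonempty →
      π.Transmitted I s t ω)
    (hcap : (∀ k, sys.Tslot * ∑ s, sys.φ s * Real.logb 2 (1 + sys.P * sys.gain s k) ≤
        (1 - sys.m) * sys.F * sys.σmax) ∨
      ∀ t s J ω, U t s J ω = J.1 ∨ U t s J ω = ∅)
    {r : Fin K → ℝ≥0}
    (hrate : ∀ᵐ ω ∂π.prob, ∀ k, ∀ ε : ℝ, 0 < ε → ∀ᶠ t : ℕ in atTop, (r k : ℝ) - ε ≤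
      ((∑ s ∈ Finset.range t, ∑ J : UserGroup K,
        if k ∈ U t s J ω then π.x s ω k J else 0 : ℕ) : ℝ) / t) :
    r ∈ sys.Γcc := by
  refine sys.mem_Γcc_of_approx fun ε hε => ?_
  set X : Fin K → ℕ → π.Ω → ℝ := fun k t ω => ((∑ s ∈ Finset.range t, ∑ J : UserGroup K,
    if k ∈ U t s J ω then π.x s ω k J else 0 : ℕ) : ℝ) / t with hX
  have hkU : ∀ t s J k, MeasurableSet {ω | k ∈ U t s J ω} := fun t s J k => by
    have : {ω | k ∈ U t s J ω} = ⋃ V : Finset (Fin K), ⋃ _ : k ∈ V, {ω | U t s J ω = V} := by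
      ext ω; simp
    rw [this]
    exact MeasurableSet.iUnion fun V => MeasurableSet.iUnion fun _ => hmeas t s J V
  have hXint : ∀ k t, Integrable (X k t) π.prob := fun k t => by
    have hm : Measurable fun ω => (∑ s ∈ Finset.range t, ∑ J : UserGroup K,
        if k ∈ U t s J ω then π.x s ω k J else 0 : ℕ) :=
      Finset.measurable_sum _ fun s _ => Finset.measurable_sum _ fun J _ =>
        Measurable.ite (hkU t s J k) (π.measurable_x s k J) measurable_const
    refine Integrable.div_const (Integrable.of_bound
      (C := ((∑ s ∈ Finset.range t, ∑ _J : UserGroup K, sys.σmax : ℕ) : ℝ))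
      (measurable_from_top.comp hm).aestronglyMeasurable (ae_of_all _ fun ω => ?_)) _
    change ‖((_ : ℕ) : ℝ)‖ ≤ _
    rw [Real.norm_of_nonneg (Nat.cast_nonneg _), Nat.cast_le]
    refine Finset.sum_le_sum fun s _ => Finset.sum_le_sum fun J _ => ?_
    split_ifs
    · exact π.x_le_σmax s ω k J
    · exact Nat.zero_le _
  have hXev : ∀ᶠ t in atTop, ∀ k, (r k : ℝ) - ε ≤ ∫ ω, X k t ω ∂π.prob :=
    eventually_all.2 fun k => eventually_le_integral (hXint k) (fun t ω => by positivity)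
      (r k).2 (hrate.mono fun ω h => h k) hε
  -- A single late slot `t` suffices: mean counts up to `t`, divided by `t`, serve as frequencies.
  obtain ⟨t, hXt, ht⟩ := (hXev.and (eventually_gt_atTop 0)).exists
  have htR : (0 : ℝ) < t := by exact_mod_cast ht
  -- Number of combinations for `J` before slot `t` that are credited to exactly `V`. Those credited
  -- to nobody drop out, `V` being nonempty.
  set N : UserGroup K → UserGroup K → π.Ω → ℝ := fun J V ω =>
    ∑ s ∈ Finset.range t, if U t s J ω = V.1 then (π.σ s ω J : ℝ) else 0 with hN
  have hN0 : ∀ J V ω, 0 ≤ N J V ω := fun J V ω => Finset.sum_nonneg fun s _ => by positivity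
  have hNle : ∀ J V ω, N J V ω ≤ t * sys.σmax := fun J V ω => by
    calc N J V ω ≤ ∑ s ∈ Finset.range t, (sys.σmax : ℝ) := by
          refine Finset.sum_le_sum fun s _ => ?_
          split_ifs
          · exact_mod_cast π.σ_le s ω J
          · positivity
      _ = t * sys.σmax := by simp
  have hNint : ∀ J V, Integrable (N J V) π.prob := fun J V => by
    refine Integrable.of_bound (C := t * sys.σmax) (Measurable.aestronglyMeasurable ?_)
      (ae_of_all _ fun ω => ?_)
    · exact Finset.measurable_sum _ fun s _ => Measurable.ite (hmeas t s J V.1)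
        (measurable_from_top.comp (π.measurable_σ s J)) measurable_const
    · rw [Real.norm_of_nonneg (hN0 J V ω)]
      exact hNle J V ω
  set Nb : UserGroup K → UserGroup K → ℝ := fun J V => (∫ ω, N J V ω ∂π.prob) / t with hNb
  have hNb0 : ∀ J V, 0 ≤ Nb J V := fun J V =>
    div_nonneg (integral_nonneg fun ω => hN0 J V ω) htR.le
  have hNble : ∀ J V, Nb J V ≤ sys.σmax := fun J V => by
    rw [hNb, div_le_iff₀ htR]
    refine (integral_mono (hNint J V) (integrable_const _) fun ω => hNle J V ω).trans (le_of_eq ?_)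
    simp [mul_comm]
  have hNbzero : ∀ J V : UserGroup K, (∀ s ω, U t s J ω ≠ V.1) → Nb J V = 0 := fun J V h => by
    have : N J V = 0 := by
      ext ω
      exact Finset.sum_eq_zero fun s _ => if_neg (h s ω)
    simp [hNb, this]
  obtain ⟨μ', hμ', hb'⟩ := sys.exists_regrouped_rates (π.meanRate_mem ht) hNb0
    (fun J V hVJ => hNbzero J V fun s ω h => hVJ (h ▸ hsub t s J ω)) (fun I => by
      have hpath : ∀ ω, ∑ J : UserGroup K with I.1 ⊆ J.1,
          ∑ V : UserGroup K with (V.1 ∩ I.1).Nonempty, sys.b J I * N J V ω ≤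
            sys.Tslot * ∑ s ∈ Finset.range t, π.μ s ω I := by
        intro ω
        classical
        refine le_trans ?_ (π.sum_transmitted_le I t ω)
        simp only [hN, Finset.mul_sum]
        simp only [Finset.sum_comm (t := Finset.range t)]
        rw [Finset.sum_filter (s := Finset.range t)]
        refine Finset.sum_le_sum fun s _ => ?_
        -- A combination is credited to at most one `V`, and if this set meets `I`, the codeword for
        -- `I` has been multicast.
        have hterm : ∀ J : UserGroup K, I.1 ⊆ J.1 →
            ∑ V : UserGroup K with (V.1 ∩ I.1).Nonempty,
              sys.b J I * (if U t s J ω = V.1 then (π.σ s ω J : ℝ) else 0) ≤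
            if π.Transmitted I s t ω then sys.b J I * π.σ s ω J else 0 := by
          intro J hIJ
          have hnn : 0 ≤ sys.b J I * (π.σ s ω J : ℝ) :=
            mul_nonneg (sys.b_nonneg J I) (Nat.cast_nonneg _)
          by_cases hU : (U t s J ω ∩ I.1).Nonempty
          · rw [if_pos (htr t s J ω I hIJ hU), Finset.sum_eq_single
              ⟨U t s J ω, hU.mono Finset.inter_subset_left⟩]
            · simp
            · intro V _ hV
              rw [if_neg fun h => hV (Subtype.ext h.symm), mul_zero]
            · intro h
              simp [hU] at h
          · rw [Finset.sum_eq_zero]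
            · split_ifs <;> simp [hnn]
            · intro V hV
              rw [if_neg, mul_zero]
              intro h
              exact hU (h ▸ (Finset.mem_filter.1 hV).2)
        refine (Finset.sum_le_sum fun J hJ => hterm J (Finset.mem_filter.1 hJ).2).trans ?_
        split_ifs
        · exact le_rfl
        · simp
      have hmono := integral_mono (integrable_finsetSum _ fun J _ => integrable_finsetSum _
        fun V _ => (hNint J V).const_mul (sys.b J I)) (π.integrable_sum_rate t I) hpath
      rw [π.integral_sum_rate ht, integral_finsetSum _ fun J _ => integrable_finsetSum _
        fun V _ => (hNint J V).const_mul (sys.b J I)] at hmono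
      simp only [integral_finsetSum _ fun V _ => (hNint _ V).const_mul _,
        integral_const_mul] at hmono
      rw [mul_comm, ← div_le_iff₀ htR, Finset.sum_div] at hmono
      simpa only [Finset.sum_div, mul_div_assoc] using hmono)
  refine ⟨μ', hμ', fun V => ∑ J, Nb J V, fun V => ⟨Finset.sum_nonneg fun J _ => hNb0 J V, ?_⟩,
    fun k => (hXt k).trans ?_, fun I => (sub_le_self _ hε.le).trans (hb' I)⟩
  -- Many `J` may contribute to one `V`; the capacities bound the sum, or else crediting is
  -- all-or-nothing and only `J = V` contributes.
  · rcases hcap with hcap | hcap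
    · exact sys.frequency_le_σmax hcap hμ' (σ := fun V => ∑ J, Nb J V)
        (fun V => Finset.sum_nonneg fun J _ => hNb0 J V) hb' V
    · refine le_trans (le_of_eq (Finset.sum_eq_single V (fun J _ hJ => ?_) (by simp)))
        (hNble V V)
      refine hNbzero J V fun s ω h => ?_
      rcases hcap t s J ω with h' | h'
      · exact hJ (Subtype.ext (h'.symm.trans h))
      · exact V.2.ne_empty (h.symm.trans h')
  · have hpath : ∀ ω, X k t ω ≤
        (∑ V : UserGroup K with k ∈ V.1, ∑ J, N J V ω) / t := by
      intro ω
      refine div_le_div_of_nonneg_right ?_ htR.le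
      simp only [hN]
      simp only [Finset.sum_comm (t := Finset.range t)]
      push_cast
      refine Finset.sum_le_sum fun s _ => ?_
      rw [Finset.sum_comm]
      refine Finset.sum_le_sum fun J _ => ?_
      split_ifs with hk
      · have hx : (π.x s ω k J : ℝ) ≤ π.σ s ω J := by
          refine Nat.cast_le.2 ((π.x_le s ω k J).trans ?_)
          split_ifs <;> simp
        refine hx.trans ?_
        refine le_trans (le_of_eq ?_) (Finset.single_le_sum
          (f := fun V : UserGroup K => if U t s J ω = V.1 then (π.σ s ω J : ℝ) else 0)
          (fun V _ => by positivity)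
          (show (⟨U t s J ω, ⟨k, hk⟩⟩ : UserGroup K) ∈ _ by simpa using hk))
        simp
      · exact Finset.sum_nonneg fun V _ => by positivity
    refine (integral_mono (hXint k t) (Integrable.div_const (integrable_finsetSum _ fun V _ =>
      integrable_finsetSum _ fun J _ => hNint J V) _) hpath).trans (le_of_eq ?_)
    rw [integral_div, integral_finsetSum _ fun V _ => integrable_finsetSum _
      fun J _ => hNint J V]
    simp only [integral_finsetSum _ fun J _ => hNint J _, Finset.sum_div, hNb]

end CachingSystem.Scheme

namespace CachingSystem

variable {K : ℕ} (sys : CachingSystem K)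

/-- All-or-nothing crediting: only combinations carried through count. Irrevocability says that this
loses `o(t)` deliveries, and no frequency is moved to a smaller set, so `σmax` is respected. -/
theorem Λcc_subset_Γcc : sys.Λcc ⊆ sys.Γcc := by
  classical
  rintro r ⟨π, hirr, hr⟩
  refine π.mem_Γcc_of_credited
    (fun t s J ω => if ∀ I : UserGroup K, I.1 ⊆ J.1 → π.Transmitted I s t ω then J.1 else ∅)
    (fun t s J V => ?_) (fun t s J ω => ?_) (fun t s J ω I hI h => ?_)
    (Or.inr fun t s J ω => ?_) ?_
  · have hm : MeasurableSet {ω | ∀ I : UserGroup K, I.1 ⊆ J.1 → π.Transmitted I s t ω} := by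
      simp only [Set.ofPred_forall]
      exact MeasurableSet.iInter fun I => MeasurableSet.iInter fun _ =>
        π.measurableSet_transmitted I s t
    have hf : Measurable[_, ⊤] fun ω =>
        if ∀ I : UserGroup K, I.1 ⊆ J.1 → π.Transmitted I s t ω then J.1 else ∅ :=
      Measurable.ite hm measurable_const measurable_const
    exact hf (MeasurableSpace.measurableSet_top (s := {V}))
  · split_ifs <;> simp
  · split_ifs at h with hc
    · exact hc I hI
    · simp at h
  · split_ifs <;> simp
  · filter_upwards [hirr, hr] with ω h1 h2 k ε hε
    have h3 := eventually_sub_le_of_liminf (h2 k) (half_pos hε)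
    have h4 := (h1 k).eventually (gt_mem_nhds (half_pos hε))
    filter_upwards [h3, h4] with t h5 h6
    rw [sub_div] at h6
    have e : (∑ s ∈ Finset.range t, ∑ J : UserGroup K,
        if k ∈ (if ∀ I : UserGroup K, I.1 ⊆ J.1 → π.Transmitted I s t ω then J.1 else ∅)
          then π.x s ω k J else 0) = π.carriedThrough k t ω := by
      refine Finset.sum_congr rfl fun s _ => Finset.sum_congr rfl fun J _ => ?_
      have hx := π.x_le s ω k J
      by_cases hc : ∀ I : UserGroup K, I.1 ⊆ J.1 → π.Transmitted I s t ω
      · rw [if_pos hc, if_pos hc]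
        split_ifs at hx ⊢ with hk
        · rfl
        · omega
      · rw [if_neg hc, if_neg hc]; simp
    rw [e]
    linarith

/-- A combination is credited to the users it has served, possibly a proper subset of its group; the
bound `σmax` must then come from `hcap`. -/
theorem ΛccRevocable_subset_Γcc
    (hcap : ∀ k, sys.Tslot * ∑ s, sys.φ s * Real.logb 2 (1 + sys.P * sys.gain s k) ≤
      (1 - sys.m) * sys.F * sys.σmax) : sys.ΛccRevocable ⊆ sys.Γcc := by
  classical
  rintro r ⟨π, hr⟩
  refine π.mem_Γcc_of_credited
    (fun t s J ω => J.1.filter fun k => ∀ I : UserGroup K, k ∈ I.1 → I.1 ⊆ J.1 →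
      π.Transmitted I s t ω)
    (fun t s J V => ?_) (fun t s J ω => Finset.filter_subset _ _) (fun t s J ω I hI h => ?_)
    (Or.inl hcap) ?_
  · have heq : {ω | (J.1.filter fun k => ∀ I : UserGroup K, k ∈ I.1 → I.1 ⊆ J.1 →
        π.Transmitted I s t ω) = V} = ⋂ k, {ω | (k ∈ J.1 ∧ ∀ I : UserGroup K, k ∈ I.1 →
        I.1 ⊆ J.1 → π.Transmitted I s t ω) ↔ k ∈ V} := by
      ext ω
      simp [Finset.ext_iff]
    rw [heq]
    refine MeasurableSet.iInter fun k => ?_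
    have hm : MeasurableSet {ω | k ∈ J.1 ∧ ∀ I : UserGroup K, k ∈ I.1 → I.1 ⊆ J.1 →
        π.Transmitted I s t ω} := by
      have hm' : MeasurableSet {ω | ∀ I : UserGroup K, k ∈ I.1 → I.1 ⊆ J.1 →
          π.Transmitted I s t ω} := by
        simp only [Set.ofPred_forall]
        exact MeasurableSet.iInter fun I => MeasurableSet.iInter fun _ => MeasurableSet.iInter
          fun _ => π.measurableSet_transmitted I s t
      exact (MeasurableSet.const (k ∈ J.1)).inter hm'
    exact hm.iff (MeasurableSet.const (k ∈ V))
  · obtain ⟨k, hk⟩ := h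
    rw [Finset.mem_inter, Finset.mem_filter] at hk
    exact hk.1.2 I hk.2 hI
  · filter_upwards [hr] with ω h2 k ε hε
    filter_upwards [eventually_sub_le_of_liminf (h2 k) hε] with t h5
    have e : (∑ s ∈ Finset.range t, ∑ J : UserGroup K,
        if k ∈ J.1.filter (fun k => ∀ I : UserGroup K, k ∈ I.1 → I.1 ⊆ J.1 →
          π.Transmitted I s t ω) then π.x s ω k J else 0) = π.delivered k t ω := by
      refine Finset.sum_congr rfl fun s _ => Finset.sum_congr rfl fun J _ => ?_
      have hx := π.x_le s ω k J
      simp only [Finset.mem_filter]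
      by_cases hk : k ∈ J.1
      · simp only [hk, true_and]
      · simp only [hk, if_false] at hx
        have : π.x s ω k J = 0 := by omega
        simp [this]
    rw [e]
    exact h5

end CachingSystem

/-! ### Strongly stable systems have admission rates in `Γcc` -/

/-- Otherwise, for a late `p`, the terms in the window from `p` to `2 * p` would total at least `p *
(2 * ∑ i, M i + 1)`, while the averages up to `2 * p` allow only `2 * p * ∑ i, M i`. -/
lemma exists_frequently_bounded {ι : Type*} [Fintype ι] (f : ι → ℕ → ℝ≥0∞)
    (hf : ∀ i, limsup (fun T : ℕ => (∑ t ∈ Finset.range T, f i t) / (T : ℝ≥0∞)) atTop < ⊤) :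
    ∃ M : ℝ≥0, ∀ n : ℕ, ∃ t ≥ n, ∀ i, f i t ≤ M := by
  choose M hM1 hM2 using fun i => ENNReal.lt_iff_exists_nnreal_btwn.1 (hf i)
  refine ⟨2 * ∑ i, M i + 1, fun n => ?_⟩
  by_contra! h
  have hev : ∀ᶠ T : ℕ in atTop, ∀ i, (∑ t ∈ Finset.range T, f i t) / (T : ℝ≥0∞) < M i :=
    eventually_all.2 fun i => eventually_lt_of_limsup_lt (hM1 i)
  obtain ⟨T0, hT0⟩ := eventually_atTop.1 hev
  set p := max (max n T0) 1 with hp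
  have hpn : n ≤ p := (le_max_left _ _).trans (le_max_left _ _)
  have hpT : T0 ≤ p := (le_max_right _ _).trans (le_max_left _ _)
  have hp1 : 1 ≤ p := le_max_right _ _
  have hupper : ∑ i, ∑ t ∈ Finset.range (p + p), f i t ≤
      ((∑ i, M i * ((p + p : ℕ) : ℝ≥0) : ℝ≥0) : ℝ≥0∞) := by
    push_cast
    refine Finset.sum_le_sum fun i _ => ?_
    have h1 := (hT0 (p + p) (by omega) i).le
    rw [ENNReal.div_le_iff (by simp; omega) (by simp)] at h1
    exact_mod_cast h1
  have hlower : ((p * (2 * ∑ i, M i + 1) : ℝ≥0) : ℝ≥0∞) ≤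
      ∑ i, ∑ t ∈ Finset.range (p + p), f i t := by
    rw [Finset.sum_comm, Finset.sum_range_add]
    refine le_trans ?_ le_add_self
    have : ∀ x ∈ Finset.range p, ((2 * ∑ i, M i + 1 : ℝ≥0) : ℝ≥0∞) ≤ ∑ i, f i (p + x) := by
      intro x _
      obtain ⟨i, hi⟩ := h (p + x) (by omega)
      exact hi.le.trans (Finset.single_le_sum (f := fun i => f i (p + x))
        (fun _ _ => zero_le) (Finset.mem_univ i))
    refine le_trans (le_of_eq ?_) (Finset.sum_le_sum this)
    simp [mul_add]
  have hlt := ENNReal.coe_le_coe.1 (hlower.trans hupper)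
  rw [← Finset.sum_mul] at hlt
  push_cast at hlt
  have hp0 : (0 : ℝ≥0) < p := by exact_mod_cast hp1
  rw [← NNReal.coe_le_coe] at hlt
  push_cast at hlt
  have hp0' : (0 : ℝ) < p := by exact_mod_cast hp1
  nlinarith

namespace CachingSystem

variable {K : ℕ} (sys : CachingSystem K)

/-- Strong stability controls time averages only, so the queue balances are evaluated at a late slot
`t` where all mean backlogs are at most one constant `M`; then `M / t` goes into the error. -/
theorem stabilityRegion_subset_Γcc : sys.stabilityRegion ⊆ sys.Γcc := by
  rintro a ⟨π, hadm, hS, hQ⟩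
  refine sys.mem_Γcc_of_approx fun ε hε => ?_
  obtain ⟨M, hM⟩ := exists_frequently_bounded (ι := Fin K ⊕ UserGroup K)
    (Sum.elim (fun k t => ∫⁻ ω, (π.S k t ω : ℝ≥0∞) ∂π.prob)
      fun I t => ∫⁻ ω, ENNReal.ofReal (π.Q I t ω) ∂π.prob) (by
      rintro (k | I)
      · exact hS k
      · exact hQ I)
  have hadm' : ∀ᶠ T : ℕ in atTop, ∀ k, (a k : ℝ) - ε / 2 <
      ((∑ t ∈ Finset.range T, ∫⁻ ω, (π.a t ω k : ℝ≥0∞) ∂π.prob) / (T : ℝ≥0∞)).toReal :=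
    eventually_all.2 fun k => ((ENNReal.tendsto_toReal ENNReal.coe_ne_top).comp
      (hadm k)).eventually (lt_mem_nhds (by simpa using hε))
  have hsmall : ∀ᶠ T : ℕ in atTop, (M : ℝ) / T < ε / 2 :=
    (tendsto_const_div_atTop_nhds_zero_nat (M : ℝ)).eventually (gt_mem_nhds (half_pos hε))
  obtain ⟨n, hn⟩ := eventually_atTop.1 ((hadm'.and hsmall).and (eventually_gt_atTop 0))
  obtain ⟨t, htn, htM⟩ := hM n
  obtain ⟨⟨hat, hMt⟩, ht⟩ := hn t htn
  have htR : (0 : ℝ) < t := by exact_mod_cast ht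
  have hσint : ∀ s J, Integrable (fun ω => (π.σ s ω J : ℝ)) π.prob := fun s J =>
    Integrable.of_bound (C := sys.σmax)
      (measurable_from_top.comp (π.measurable_σ s J)).aestronglyMeasurable
      (ae_of_all _ fun ω => by
        change ‖((_ : ℕ) : ℝ)‖ ≤ _
        rw [Real.norm_of_nonneg (Nat.cast_nonneg _), Nat.cast_le]
        exact π.σ_le s ω J)
  set tot : UserGroup K → ℝ := fun J => ∑ s ∈ Finset.range t, ∫ ω, (π.σ s ω J : ℝ) ∂π.prob
    with htot
  have htot0 : ∀ J, 0 ≤ tot J := fun J =>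
    Finset.sum_nonneg fun s _ => integral_nonneg fun ω => Nat.cast_nonneg _
  refine ⟨π.meanRate t, π.meanRate_mem ht, fun J => tot J / t,
    fun J => ⟨div_nonneg (htot0 J) htR.le, ?_⟩, fun k => ?_, fun I => ?_⟩
  · rw [div_le_iff₀ htR]
    calc tot J ≤ ∑ s ∈ Finset.range t, (sys.σmax : ℝ) := by
          refine Finset.sum_le_sum fun s _ => ?_
          refine (integral_mono (hσint s J) (integrable_const (sys.σmax : ℝ)) fun ω =>
            Nat.cast_le.2 (π.σ_le s ω J)).trans (le_of_eq (by simp))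
      _ = sys.σmax * t := by simp [mul_comm]
  · have hc : ∀ s, ∫⁻ ω, ((∑ J : UserGroup K with k ∈ J.1, π.σ s ω J : ℕ) : ℝ≥0∞) ∂π.prob =
        ENNReal.ofReal (∑ J : UserGroup K with k ∈ J.1, ∫ ω, (π.σ s ω J : ℝ) ∂π.prob) := by
      intro s
      rw [← integral_finsetSum _ fun J _ => hσint s J, ofReal_integral_eq_lintegral_ofReal
        (integrable_finsetSum _ fun J _ => hσint s J)
        (ae_of_all _ fun ω => Finset.sum_nonneg fun J _ => Nat.cast_nonneg _)]
      refine lintegral_congr fun ω => ?_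
      rw [← Nat.cast_sum, ENNReal.ofReal_natCast]
    -- Admissions have no a priori bound, so the balance is kept in `ℝ≥0∞`; its right-hand side is
    -- finite, which permits the passage to `ℝ`.
    have h1 : ∑ s ∈ Finset.range t, ∫⁻ ω, (π.a s ω k : ℝ≥0∞) ∂π.prob ≤
        M + ENNReal.ofReal (∑ J : UserGroup K with k ∈ J.1, tot J) := by
      have hma : ∀ s, Measurable fun ω => (π.a s ω k : ℝ≥0∞) := fun s =>
        measurable_from_top.comp (π.measurable_a s k)
      have hmc : ∀ s, Measurable fun ω =>
          ((∑ J : UserGroup K with k ∈ J.1, π.σ s ω J : ℕ) : ℝ≥0∞) := fun s =>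
        measurable_from_top.comp (Finset.measurable_sum _ fun J _ => π.measurable_σ s J)
      have hmS : Measurable fun ω => (π.S k t ω : ℝ≥0∞) :=
        measurable_from_top.comp (π.measurable_S k t)
      calc ∑ s ∈ Finset.range t, ∫⁻ ω, (π.a s ω k : ℝ≥0∞) ∂π.prob
          = ∫⁻ ω, ∑ s ∈ Finset.range t, (π.a s ω k : ℝ≥0∞) ∂π.prob :=
            (lintegral_finsetSum _ fun s _ => hma s).symm
        _ ≤ ∫⁻ ω, ((π.S k t ω : ℝ≥0∞) + ∑ s ∈ Finset.range t,
              ((∑ J : UserGroup K with k ∈ J.1, π.σ s ω J : ℕ) : ℝ≥0∞)) ∂π.prob := by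
            refine lintegral_mono fun ω => ?_
            have := sum_le_userBacklog_add (fun s => π.a s ω k)
              (fun s => ∑ J : UserGroup K with k ∈ J.1, π.σ s ω J) t
            rw [← Nat.cast_sum, ← Nat.cast_sum, ← Nat.cast_add]
            exact Nat.cast_le.2 this
        _ = ∫⁻ ω, (π.S k t ω : ℝ≥0∞) ∂π.prob + ∑ s ∈ Finset.range t,
              ∫⁻ ω, ((∑ J : UserGroup K with k ∈ J.1, π.σ s ω J : ℕ) : ℝ≥0∞) ∂π.prob := by
            rw [lintegral_add_left hmS, lintegral_finsetSum _ fun s _ => hmc s]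
        _ ≤ _ := by
            refine add_le_add (htM (Sum.inl k)) (le_of_eq ?_)
            simp only [hc, htot]
            rw [← ENNReal.ofReal_sum_of_nonneg fun s _ => Finset.sum_nonneg fun J _ =>
              integral_nonneg fun ω => Nat.cast_nonneg _, Finset.sum_comm]
    have h2 := (hat k).le
    rw [ENNReal.toReal_div, ENNReal.toReal_natCast] at h2
    have h3 := ENNReal.toReal_mono (by simp) h1
    rw [ENNReal.toReal_add (by simp) (by simp), ENNReal.coe_toReal, ENNReal.toReal_ofReal
      (Finset.sum_nonneg fun J _ => htot0 J)] at h3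
    have h4 := div_le_div_of_nonneg_right h3 htR.le
    rw [add_div] at h4
    rw [← Finset.sum_div]
    linarith
  · have hcr : Integrable (π.created I t) π.prob :=
      integrable_finsetSum _ fun s _ => integrable_finsetSum _ fun J _ =>
        (hσint s J).const_mul _
    have hQint : Integrable (π.Q I t) π.prob :=
      hcr.mono' (π.measurable_Q I t).aestronglyMeasurable (ae_of_all _ fun ω => by
        rw [Real.norm_of_nonneg (π.Q_nonneg I t ω)]
        exact sub_nonneg.1 (π.sent_nonneg I t ω))
    have h1 := integral_mono hcr (hQint.add (π.integrable_sum_rate t I)) fun ω => by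
      have := π.sent_le I t ω
      unfold Scheme.sent at this
      change _ ≤ π.Q I t ω + _
      linarith
    have h2 : ∫ ω, π.Q I t ω ∂π.prob ≤ M := by
      rw [integral_eq_lintegral_of_nonneg_ae (ae_of_all _ fun ω => π.Q_nonneg I t ω)
        (π.measurable_Q I t).aestronglyMeasurable]
      exact ENNReal.toReal_le_coe_of_le_coe (htM (Sum.inr I))
    have h3 : ∫ ω, π.created I t ω ∂π.prob =
        ∑ J : UserGroup K with I.1 ⊆ J.1, sys.b J I * tot J := by
      unfold Scheme.created Scheme.arrivals
      rw [integral_finsetSum _ fun s _ => integrable_finsetSum _ fun J _ =>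
        (hσint s J).const_mul _]
      simp only [integral_finsetSum _ fun J _ => (hσint _ J).const_mul _, integral_const_mul]
      rw [Finset.sum_comm]
      simp only [htot, Finset.mul_sum]
    simp only [Pi.add_apply] at h1
    rw [integral_add hQint (π.integrable_sum_rate t I), π.integral_sum_rate ht, h3] at h1
    have h4 : (∑ J : UserGroup K with I.1 ⊆ J.1, sys.b J I * tot J) / t ≤
        (M + t * (sys.Tslot * π.meanRate t I)) / t :=
      div_le_div_of_nonneg_right (by linarith) htR.le
    rw [add_div, mul_div_cancel_left₀ _ htR.ne', Finset.sum_div] at h4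
    simp only [mul_div_assoc] at h4
    linarith

end CachingSystem

/-! ### Backlogs under slack -/

/-- Take for `s` the last slot at which service had cleared the queue: no service is wasted
afterwards. Arrivals enter after service, hence the extra `A`. -/
lemma codewordBacklog_le_net_input {arr srv : ℕ → ℝ} {A : ℝ} (hA0 : 0 ≤ A)
    (hA : ∀ t, arr t ≤ A) (t : ℕ) : ∃ s ≤ t, codewordBacklog arr srv t ≤
      (∑ i ∈ Finset.range t, arr i - ∑ i ∈ Finset.range t, srv i) -
      (∑ i ∈ Finset.range s, arr i - ∑ i ∈ Finset.range s, srv i) + A := by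
  induction t with
  | zero => exact ⟨0, le_rfl, by simpa [codewordBacklog] using hA0⟩
  | succ t ih =>
    obtain ⟨s, hs, h⟩ := ih
    rw [codewordBacklog]
    rcases le_total (codewordBacklog arr srv t - srv t) 0 with h0 | h0
    · refine ⟨t + 1, le_rfl, ?_⟩
      rw [max_eq_right h0]
      linarith [hA t]
    · refine ⟨s, by omega, ?_⟩
      rw [max_eq_left h0, Finset.sum_range_succ, Finset.sum_range_succ]
      linarith

lemma cast_userBacklog (a c : ℕ → ℕ) (t : ℕ) :
    (userBacklog a c t : ℝ) = codewordBacklog (fun s => (a s : ℝ)) (fun s => (c s : ℝ)) t := by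
  induction t with
  | zero => simp [userBacklog, codewordBacklog]
  | succ t ih =>
    rw [userBacklog, codewordBacklog, ← ih]
    push_cast
    congr 1
    rcases le_total (userBacklog a c t) (c t) with h | h
    · have h' : (userBacklog a c t : ℝ) ≤ c t := by exact_mod_cast h
      rw [Nat.sub_eq_zero_of_le h, max_eq_right (by linarith)]
      simp
    · have h' : (c t : ℝ) ≤ userBacklog a c t := by exact_mod_cast h
      rw [Nat.cast_sub h, max_eq_left (by linarith)]

/-- Trades lumpy arrivals for a constant inflow `l`, as needed for the drift estimate. The
cumulative deviation, made nonnegative by `c`, is the price. -/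
lemma codewordBacklog_le_smooth {arr srv : ℕ → ℝ} {l c : ℝ}
    (h : ∀ t, l * t - c ≤ ∑ s ∈ Finset.range t, arr s) (t : ℕ) :
    codewordBacklog arr srv t ≤ codewordBacklog (fun _ => l) srv t +
      (∑ s ∈ Finset.range t, arr s - l * t + c) := by
  induction t with
  | zero => simpa [codewordBacklog] using h 0
  | succ t ih =>
    have h1 := h t
    have h2 : max (codewordBacklog arr srv t - srv t) 0 ≤
        max (codewordBacklog (fun _ => l) srv t - srv t) 0 +
          (∑ s ∈ Finset.range t, arr s - l * t + c) := by
      refine max_le ?_ (add_nonneg (le_max_right _ _) (by linarith))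
      have := le_max_left (codewordBacklog (fun _ => l) srv t - srv t) 0
      linarith
    rw [codewordBacklog, codewordBacklog, Finset.sum_range_succ]
    push_cast
    linarith

/-- The net input since the last clearing is a nonpositive drift plus the error difference `e t - e
s`. The error is at most `ε / 4 * t + C`, where `C` covers the finitely many early slots, so the
bound is uniform in `s ≤ t`. -/
theorem tendsto_codewordBacklog_div {arr srv : ℕ → ℝ} {A l c : ℝ} (ha : ∀ t, 0 ≤ arr t)
    (hA : ∀ t, arr t ≤ A) (hlc : l < c)
    (harr : Tendsto (fun t : ℕ => (∑ s ∈ Finset.range t, arr s) / t) atTop (𝓝 l))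
    (hsrv : Tendsto (fun t : ℕ => (∑ s ∈ Finset.range t, srv s) / t) atTop (𝓝 c)) :
    Tendsto (fun t : ℕ => codewordBacklog arr srv t / t) atTop (𝓝 0) := by
  have hA0 : 0 ≤ A := (ha 0).trans (hA 0)
  set W : ℕ → ℝ := fun t => ∑ s ∈ Finset.range t, arr s - ∑ s ∈ Finset.range t, srv s with hW
  set e : ℕ → ℝ := fun t => W t - (l - c) * t with he
  have hWlim : Tendsto (fun t : ℕ => W t / t) atTop (𝓝 (l - c)) := by
    simpa only [hW, sub_div] using harr.sub hsrv
  rw [Metric.tendsto_atTop]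
  intro ε hε
  have h1 : ∀ᶠ t : ℕ in atTop, |e t| ≤ ε / 4 * t := by
    filter_upwards [Metric.tendsto_nhds.1 hWlim (ε / 4) (by positivity), eventually_gt_atTop 0]
      with t ht ht0
    have htR : (0 : ℝ) < t := by exact_mod_cast ht0
    rw [Real.dist_eq] at ht
    have : e t = (W t / t - (l - c)) * t := by
      simp only [he]; field_simp
    rw [this, abs_mul, abs_of_pos htR]
    exact mul_le_mul_of_nonneg_right ht.le htR.le
  obtain ⟨N, hN⟩ := eventually_atTop.1 h1
  set C : ℝ := ∑ t ∈ Finset.range N, |e t| with hC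
  have hC0 : 0 ≤ C := Finset.sum_nonneg fun t _ => abs_nonneg _
  have hall : ∀ t, |e t| ≤ ε / 4 * t + C := by
    intro t
    rcases lt_or_ge t N with h | h
    · have := Finset.single_le_sum (f := fun t => |e t|) (fun t _ => abs_nonneg _)
        (Finset.mem_range.2 h)
      have h3 : 0 ≤ ε / 4 * t := by positivity
      linarith
    · linarith [hN t h]
  have hlim : ∀ᶠ t : ℕ in atTop, (2 * C + A) / t < ε / 4 :=
    (tendsto_const_div_atTop_nhds_zero_nat (2 * C + A)).eventually (gt_mem_nhds (by positivity))
  obtain ⟨M, hM⟩ := eventually_atTop.1 (hlim.and (eventually_gt_atTop 0))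
  refine ⟨M, fun t ht => ?_⟩
  obtain ⟨h4, h5⟩ := hM t ht
  have htR : (0 : ℝ) < t := by exact_mod_cast h5
  have hQ0 := codewordBacklog_nonneg (srv := srv) ha t
  rw [Real.dist_eq, sub_zero, abs_of_nonneg (div_nonneg hQ0 htR.le), div_lt_iff₀ htR]
  obtain ⟨s, hs, hQ⟩ := codewordBacklog_le_net_input (srv := srv) hA0 hA t
  have hsR : (s : ℝ) ≤ t := by exact_mod_cast hs
  change _ ≤ W t - W s + A at hQ
  have h6 : W t - W s = e t - e s + (l - c) * (t - s) := by simp only [he]; ring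
  have h7 : (l - c) * ((t : ℝ) - s) ≤ 0 :=
    mul_nonpos_of_nonpos_of_nonneg (by linarith) (by linarith)
  have h8 := (le_abs_self _).trans (hall t)
  have h9 := (neg_le_abs _).trans (hall s)
  have h10 : ε / 4 * (s : ℝ) ≤ ε / 4 * t := mul_le_mul_of_nonneg_left hsR (by positivity)
  rw [div_lt_iff₀ htR] at h4
  have h11 : 0 < ε * t := by positivity
  linarith

/-- Quadratic Lyapunov bound on the mean backlog. -/
theorem sum_integral_backlog_le {Ω : Type*} [MeasurableSpace Ω] {prob : Measure Ω}
    [IsProbabilityMeasure prob] {srv : ℕ → Ω → ℝ} {l c V : ℝ} (hl : 0 ≤ l) (hlc : l < c)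
    (hm : ∀ t, Measurable (srv t)) (h0 : ∀ t ω, 0 ≤ srv t ω) (hV : ∀ t ω, srv t ω ≤ V)
    (hmean : ∀ t, ∫ ω, srv t ω ∂prob = c)
    (hind : ∀ t, ProbabilityTheory.IndepFun
      (fun ω => codewordBacklog (fun _ => l) (fun s => srv s ω) t) (srv t) prob) (T : ℕ) :
    ∑ t ∈ Finset.range T, ∫ ω, codewordBacklog (fun _ => l) (fun s => srv s ω) t ∂prob ≤
      T * ((V ^ 2 + l ^ 2) / (2 * (c - l))) := by
  set q : ℕ → Ω → ℝ := fun t ω => codewordBacklog (fun _ => l) (fun s => srv s ω) t with hq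
  have hq0 : ∀ t ω, 0 ≤ q t ω := fun t ω => codewordBacklog_nonneg (fun _ => hl) t
  have hqm : ∀ t, Measurable (q t) := fun t =>
    measurable_codewordBacklog t (fun _ _ => measurable_const) fun s _ => hm s
  have hqle : ∀ t ω, q t ω ≤ t * l := fun t ω => by
    simpa using codewordBacklog_le_sum (arr := fun _ => l) (fun _ => hl) (fun s => h0 s ω) t
  have hqi : ∀ t, Integrable (q t) prob := fun t =>
    Integrable.of_bound (C := t * l) (hqm t).aestronglyMeasurable (ae_of_all _ fun ω => by
      rw [Real.norm_of_nonneg (hq0 t ω)]; exact hqle t ω)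
  have hq2i : ∀ t, Integrable (fun ω => q t ω ^ 2) prob := fun t =>
    Integrable.of_bound (C := (t * l) ^ 2) ((hqm t).pow_const 2).aestronglyMeasurable
      (ae_of_all _ fun ω => by
        rw [Real.norm_of_nonneg (sq_nonneg _)]
        exact pow_le_pow_left₀ (hq0 t ω) (hqle t ω) 2)
  have hsi : ∀ t, Integrable (srv t) prob := fun t =>
    Integrable.of_bound (C := V) (hm t).aestronglyMeasurable (ae_of_all _ fun ω => by
      rw [Real.norm_of_nonneg (h0 t ω)]; exact hV t ω)
  have hqsi : ∀ t, Integrable (fun ω => q t ω * srv t ω) prob := fun t =>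
    (hind t).integrable_mul (hqi t) (hsi t)
  have hdrift : ∀ t, ∫ ω, q (t + 1) ω ^ 2 ∂prob ≤
      ∫ ω, q t ω ^ 2 ∂prob + (V ^ 2 + l ^ 2) - 2 * (c - l) * ∫ ω, q t ω ∂prob := by
    intro t
    have hpt : ∀ ω, q (t + 1) ω ^ 2 ≤
        (q t ω ^ 2 + (V ^ 2 + l ^ 2)) + ((2 * l) * q t ω - 2 * (q t ω * srv t ω)) := by
      intro ω
      have hv := h0 t ω
      have hvV : srv t ω ^ 2 ≤ V ^ 2 := pow_le_pow_left₀ hv (hV t ω) 2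
      have hqt := hq0 t ω
      have hstep : q (t + 1) ω = max (q t ω - srv t ω) 0 + l := rfl
      rw [hstep]
      rcases le_total (q t ω - srv t ω) 0 with h | h
      · rw [max_eq_right h]
        nlinarith [sq_nonneg (q t ω - srv t ω), mul_nonneg hl hqt]
      · rw [max_eq_left h]
        nlinarith [mul_nonneg hl hv]
    have hA : Integrable (fun ω => q t ω ^ 2 + (V ^ 2 + l ^ 2)) prob :=
      (hq2i t).add (integrable_const _)
    have hB : Integrable (fun ω => (2 * l) * q t ω - 2 * (q t ω * srv t ω)) prob :=
      ((hqi t).const_mul _).sub ((hqsi t).const_mul _)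
    refine (integral_mono (hq2i (t + 1)) (hA.add hB) hpt).trans (le_of_eq ?_)
    -- Independence makes the cross term `c` times the mean backlog, leaving the negative drift `-2
    -- * (c - l)` times that mean.
    have hmul : ∫ ω, q t ω * srv t ω ∂prob = (∫ ω, q t ω ∂prob) * c := by
      rw [← hmean t]
      exact (hind t).integral_fun_mul_eq_mul_integral (hqm t).aestronglyMeasurable
        (hm t).aestronglyMeasurable
    rw [integral_add' hA hB, integral_add (hq2i t) (integrable_const _),
      integral_sub ((hqi t).const_mul _) ((hqsi t).const_mul _), integral_const_mul,
      integral_const_mul, hmul]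
    simp
    ring
  have hsum : ∀ T : ℕ, ∫ ω, q T ω ^ 2 ∂prob + 2 * (c - l) * ∑ t ∈ Finset.range T,
      ∫ ω, q t ω ∂prob ≤ T * (V ^ 2 + l ^ 2) := by
    intro T
    induction T with
    | zero => simp [hq, codewordBacklog]
    | succ T ih =>
      rw [Finset.sum_range_succ]
      push_cast
      linarith [hdrift T]
  have h1 : 0 ≤ ∫ ω, q T ω ^ 2 ∂prob := integral_nonneg fun ω => sq_nonneg _
  have h2 := hsum T
  rw [← mul_div_assoc, le_div_iff₀ (by linarith)]
  linarith

/-! ### Integer sequences with a prescribed rate -/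

/-- Increments of `⌊c t⌋`. -/
def floorIncrement (c : ℝ) (t : ℕ) : ℕ := ⌊c * (t + 1 : ℕ)⌋₊ - ⌊c * t⌋₊

lemma sum_floorIncrement {c : ℝ} (hc : 0 ≤ c) (t : ℕ) :
    ∑ s ∈ Finset.range t, floorIncrement c s = ⌊c * t⌋₊ := by
  have := Finset.sum_range_tsub (f := fun t : ℕ => ⌊c * t⌋₊) (fun s t hst => Nat.floor_mono
    (mul_le_mul_of_nonneg_left (Nat.cast_le.2 hst) hc)) t
  simpa [floorIncrement] using this

/-- An integer shift passes through the floor, so the increments never exceed an integer bound on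
`c`. -/
lemma floorIncrement_le {c : ℝ} (hc : 0 ≤ c) {m : ℕ} (hm : c ≤ m) (t : ℕ) :
    floorIncrement c t ≤ m := by
  unfold floorIncrement
  rw [Nat.sub_le_iff_le_add, add_comm m, ← Nat.floor_add_natCast (by positivity)]
  refine Nat.floor_mono ?_
  push_cast
  linarith

lemma exists_le_sum_eq {ι : Type*} [Fintype ι] (u : ι → ℕ) (n : ℕ) (hn : n ≤ ∑ i, u i) :
    ∃ x : ι → ℕ, (∀ i, x i ≤ u i) ∧ ∑ i, x i = n := by
  classical
  induction n with
  | zero => exact ⟨0, fun _ => Nat.zero_le _, by simp⟩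
  | succ n ih =>
    obtain ⟨x, hx, hs⟩ := ih (by omega)
    obtain ⟨i, -, hi⟩ := Finset.exists_lt_of_sum_lt (s := Finset.univ) (f := x) (g := u)
      (by omega)
    refine ⟨Function.update x i (x i + 1), fun j => ?_, ?_⟩
    · by_cases h : j = i
      · subst h; simpa using hi
      · simpa [h] using hx j
    · rw [Finset.sum_update_of_mem (Finset.mem_univ i), ← hs,
        ← Finset.add_sum_erase _ _ (Finset.mem_univ i), Finset.sdiff_singleton_eq_erase]
      ring

lemma tendsto_ennreal_div {D : ℕ → ℕ} {r : ℝ≥0}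
    (h : Tendsto (fun t : ℕ => (D t : ℝ) / t) atTop (𝓝 r)) :
    Tendsto (fun t : ℕ => (D t : ℝ≥0∞) / (t : ℝ≥0∞)) atTop (𝓝 r) := by
  have h1 := ENNReal.tendsto_ofReal h
  rw [ENNReal.ofReal_coe_nnreal] at h1
  refine h1.congr' ?_
  filter_upwards [eventually_gt_atTop 0] with t ht
  rw [ENNReal.ofReal_div_of_pos (by exact_mod_cast ht), ENNReal.ofReal_natCast,
    ENNReal.ofReal_natCast]

/-! ### The i.i.d. channel -/

namespace CachingSystem

variable {K : ℕ} (sys : CachingSystem K)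

/-- The law of the channel state. -/
def channelLaw : Measure (Fin sys.numStates) :=
  ∑ s, ENNReal.ofReal (sys.φ s) • Measure.dirac s

lemma channelLaw_singleton (s : Fin sys.numStates) :
    sys.channelLaw {s} = ENNReal.ofReal (sys.φ s) := by
  simp [channelLaw, Set.indicator_apply]

instance : IsProbabilityMeasure sys.channelLaw := by
  refine ⟨?_⟩
  simp only [channelLaw, Measure.coe_finsetSum, Finset.sum_apply, Measure.smul_apply,
    measure_univ, smul_eq_mul, mul_one]
  rw [← ENNReal.ofReal_sum_of_nonneg fun s _ => sys.φ_nonneg s, sys.φ_sum, ENNReal.ofReal_one]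

/-- The law of the sequence of channel states. -/
def pathLaw : Measure (ℕ → Fin sys.numStates) := Measure.infinitePi fun _ => sys.channelLaw

instance : IsProbabilityMeasure sys.pathLaw := by unfold pathLaw; infer_instance

lemma map_eval_pathLaw (t : ℕ) : sys.pathLaw.map (fun ω => ω t) = sys.channelLaw :=
  Measure.infinitePi_map_eval (fun _ => sys.channelLaw) t

lemma iIndepFun_pathLaw :
    ProbabilityTheory.iIndepFun (fun (t : ℕ) (ω : ℕ → Fin sys.numStates) => ω t) sys.pathLaw :=
  ProbabilityTheory.iIndepFun_infinitePi (P := fun _ : ℕ => sys.channelLaw)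
    (X := fun _ => id) fun _ => measurable_id

lemma integral_pathLaw (g : Fin sys.numStates → ℝ) (t : ℕ) :
    ∫ ω, g (ω t) ∂sys.pathLaw = ∑ s, sys.φ s * g s := by
  rw [← integral_map (f := g) (φ := fun ω : ℕ → Fin sys.numStates => ω t)
    (measurable_pi_apply t).aemeasurable measurable_from_top.aestronglyMeasurable,
    map_eval_pathLaw, integral_fintype Integrable.of_finite]
  refine Finset.sum_congr rfl fun s _ => ?_
  rw [Measure.real, channelLaw_singleton, ENNReal.toReal_ofReal (sys.φ_nonneg s), smul_eq_mul]

lemma ae_tendsto_average (g : Fin sys.numStates → ℝ) :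
    ∀ᵐ ω ∂sys.pathLaw, Tendsto (fun t : ℕ => (∑ s ∈ Finset.range t, g (ω s)) / t) atTop
      (𝓝 (∑ s, sys.φ s * g s)) := by
  have hg : Measurable g := measurable_from_top
  have := ProbabilityTheory.strong_law_ae_real (μ := sys.pathLaw) (fun t ω => g (ω t)) ?_ ?_ ?_
  · simpa only [integral_pathLaw] using this
  · obtain ⟨C, hC⟩ := (Set.finite_range fun s => ‖g s‖).bddAbove
    exact Integrable.of_bound (C := C)
      (hg.comp (measurable_pi_apply 0)).aestronglyMeasurable
      (ae_of_all _ fun ω => hC ⟨ω 0, rfl⟩)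
  · intro i j hij
    exact (sys.iIndepFun_pathLaw.indepFun hij).comp hg hg
  · intro i
    refine ProbabilityTheory.IdentDistrib.comp (u := g) ⟨(measurable_pi_apply i).aemeasurable,
      (measurable_pi_apply 0).aemeasurable, ?_⟩ hg
    rw [map_eval_pathLaw, map_eval_pathLaw]

lemma indep_piLE (t : ℕ) : ProbabilityTheory.Indep
    (Filtration.piLE (X := fun _ : ℕ => Fin sys.numStates) t)
    (MeasurableSpace.comap (fun ω : ℕ → Fin sys.numStates => ω (t + 1)) ⊤) sys.pathLaw := by
  have h := sys.iIndepFun_pathLaw.indepFun_finset (Finset.Iic t) {t + 1} (by simp)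
    fun i => measurable_pi_apply i
  have h2 := h.comp measurable_id
    (measurable_pi_apply (⟨t + 1, by simp⟩ : ({t + 1} : Finset ℕ)))
  rw [Filtration.piLE_eq_comap_frestrictLe]
  exact h2

end CachingSystem

/-! ### A scheme for the rates in the interior of `Γcc` -/

namespace CachingSystem

variable {K : ℕ} (sys : CachingSystem K)

/-- Files admitted and combinations made at rates `r` and `f` in every slot, and rates `ν s`
whenever the channel is in the state `s`. -/
structure RatePlan where
  r : Fin K → ℝ≥0
  f : UserGroup K → ℝ
  f_nonneg : ∀ J, 0 ≤ f J
  f_le : ∀ J, f J ≤ sys.σmax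
  ν : Fin sys.numStates → UserGroup K → ℝ
  ν_mem : ∀ s, ν s ∈ capacityRegion sys.P (sys.gain s)

namespace RatePlan

variable {sys} (p : RatePlan sys)

/-- Demand for files of user `k` in slot `t`. -/
def demand (k : Fin K) (t : ℕ) : ℕ :=
  ∑ J : UserGroup K with k ∈ J.1, floorIncrement (p.f J) t

/-- Backlog of the user queue of `k`. -/
def backlog (k : Fin K) (t : ℕ) : ℕ :=
  userBacklog (floorIncrement (p.r k)) (p.demand k) t

lemma exists_assignment (t : ℕ) (k : Fin K) : ∃ x : UserGroup K → ℕ,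
    (∀ J, x J ≤ if k ∈ J.1 then floorIncrement (p.f J) t else 0) ∧
      ∑ J, x J = min (p.backlog k t) (p.demand k t) :=
  exists_le_sum_eq _ _ ((min_le_right _ _).trans (le_of_eq (Finset.sum_filter _ _)))

/-- The scheme that carries out the plan. -/
def scheme : Scheme sys where
  Ω := ℕ → Fin sys.numStates
  prob := sys.pathLaw
  ℱ := Filtration.piLE
  h t ω := ω t
  h_adapted t := by
    have h : Measurable fun y : (i : Set.Iic t) → Fin sys.numStates => y ⟨t, Set.self_mem_Iic⟩ :=
      measurable_pi_apply (⟨t, Set.self_mem_Iic⟩ : Set.Iic t)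
    exact h.comp (comap_measurable (Preorder.restrictLe (π := fun _ : ℕ => Fin sys.numStates) t))
  h_law t s := by
    rw [← sys.channelLaw_singleton, ← sys.map_eval_pathLaw t,
      Measure.map_apply (measurable_pi_apply t) (measurableSet_singleton s)]
  h_indep := sys.indep_piLE
  a t _ k := floorIncrement (p.r k) t
  a_adapted _ := measurable_const
  σ t _ J := floorIncrement (p.f J) t
  σ_adapted _ := measurable_const
  σ_le t _ J := floorIncrement_le (p.f_nonneg J) (p.f_le J) t
  μ t ω := p.ν (ω t)
  μ_adapted t := by
    have h : Measurable fun y : (i : Set.Iic t) → Fin sys.numStates => p.ν (y ⟨t, Set.self_mem_Iic⟩) :=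
      (measurable_from_top (f := p.ν)).comp (measurable_pi_apply (⟨t, Set.self_mem_Iic⟩ : Set.Iic t))
    exact h.comp (comap_measurable (Preorder.restrictLe (π := fun _ : ℕ => Fin sys.numStates) t))
  μ_mem t ω := p.ν_mem (ω t)
  x t _ k := (p.exists_assignment t k).choose
  x_adapted _ := measurable_const
  x_le t _ k := (p.exists_assignment t k).choose_spec.1
  x_sum t _ k := (p.exists_assignment t k).choose_spec.2

lemma sum_x_eq (k : Fin K) (t : ℕ) (ω : p.scheme.Ω) :
    ∑ s ∈ Finset.range t, ∑ J, p.scheme.x s ω k J + p.backlog k t = ⌊(p.r k : ℝ) * t⌋₊ := by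
  rw [← sum_floorIncrement (p.r k).coe_nonneg, ← sum_min_add_userBacklog (floorIncrement (p.r k)) (p.demand k)]
  congr 1
  exact Finset.sum_congr rfl fun s _ => p.scheme.x_sum s ω k

lemma sum_demand (k : Fin K) (t : ℕ) : ∑ s ∈ Finset.range t, p.demand k s =
    ∑ J : UserGroup K with k ∈ J.1, ⌊p.f J * t⌋₊ := by
  unfold demand
  rw [Finset.sum_comm]
  exact Finset.sum_congr rfl fun J _ => sum_floorIncrement (p.f_nonneg J) t

/-- Cumulative admissions and demands are floors, within `1` and `n` of straight lines, so the
backlog is bounded even without strict slack; `R` is the one-slot burst. -/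
lemma exists_backlog_le {k : Fin K}
    (hk : (p.r k : ℝ) ≤ ∑ J : UserGroup K with k ∈ J.1, p.f J) :
    ∃ B : ℕ, ∀ t, p.backlog k t ≤ B := by
  set n : ℕ := (Finset.univ.filter fun J : UserGroup K => k ∈ J.1).card with hn
  set R : ℕ := ⌈(p.r k : ℝ)⌉₊ with hR
  refine ⟨1 + n + R, fun t => ?_⟩
  obtain ⟨s, hst, h⟩ := codewordBacklog_le_net_input (A := R)
    (arr := fun s => (floorIncrement (p.r k) s : ℝ)) (srv := fun s => (p.demand k s : ℝ))
    (Nat.cast_nonneg _)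
    (fun t => Nat.cast_le.2 (floorIncrement_le (p.r k).coe_nonneg (Nat.le_ceil _) t)) t
  rw [← cast_userBacklog] at h
  simp only [← Nat.cast_sum, sum_demand, sum_floorIncrement (p.r k).coe_nonneg] at h
  change (p.backlog k t : ℝ) ≤ _ at h
  push_cast at h
  have hsR : (s : ℝ) ≤ t := by exact_mod_cast hst
  have h1 : ((⌊(p.r k : ℝ) * t⌋₊ : ℕ) : ℝ) ≤ p.r k * t := Nat.floor_le (by positivity)
  have h2 := Nat.lt_floor_add_one ((p.r k : ℝ) * s)
  have h3 : (∑ J : UserGroup K with k ∈ J.1, p.f J) * t - n ≤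
      ∑ J : UserGroup K with k ∈ J.1, ((⌊p.f J * t⌋₊ : ℕ) : ℝ) := by
    rw [hn, Finset.sum_mul, Finset.cast_card, ← Finset.sum_sub_distrib]
    exact Finset.sum_le_sum fun J _ => by linarith [Nat.lt_floor_add_one (p.f J * t)]
  have h4 : ∑ J : UserGroup K with k ∈ J.1, ((⌊p.f J * s⌋₊ : ℕ) : ℝ) ≤
      (∑ J : UserGroup K with k ∈ J.1, p.f J) * s := by
    rw [Finset.sum_mul]
    exact Finset.sum_le_sum fun J _ =>
      Nat.floor_le (mul_nonneg (p.f_nonneg J) (Nat.cast_nonneg _))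
  have h5 := mul_le_mul_of_nonneg_right hk (show (0 : ℝ) ≤ t - s by linarith)
  have : (p.backlog k t : ℝ) ≤ ((1 + n + R : ℕ) : ℝ) := by
    push_cast
    linarith
  exact_mod_cast this

/-- Mean number of bits per slot for the queue of `I`. -/
def load (I : UserGroup K) : ℝ := ∑ J : UserGroup K with I.1 ⊆ J.1, sys.b J I * p.f J

/-- Mean service of the queue of `I`. -/
def service (I : UserGroup K) : ℝ := sys.Tslot * ∑ s, sys.φ s * p.ν s I

/-- Bound on the number of bits by which the arrivals deviate from the load. -/
def burst (I : UserGroup K) : ℝ := ∑ J : UserGroup K with I.1 ⊆ J.1, sys.b J I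

lemma load_nonneg (I : UserGroup K) : 0 ≤ p.load I :=
  Finset.sum_nonneg fun J _ => mul_nonneg (sys.b_nonneg J I) (p.f_nonneg J)

lemma created_eq (I : UserGroup K) (t : ℕ) (ω : p.scheme.Ω) : p.scheme.created I t ω =
    ∑ J : UserGroup K with I.1 ⊆ J.1, sys.b J I * ((⌊p.f J * t⌋₊ : ℕ) : ℝ) := by
  unfold Scheme.created Scheme.arrivals
  rw [Finset.sum_comm]
  refine Finset.sum_congr rfl fun J _ => ?_
  rw [← Finset.mul_sum, ← Nat.cast_sum]
  congr 2
  exact sum_floorIncrement (p.f_nonneg J) t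

lemma created_le (I : UserGroup K) (t : ℕ) (ω : p.scheme.Ω) :
    p.scheme.created I t ω ≤ p.load I * t := by
  rw [created_eq, load, Finset.sum_mul]
  refine Finset.sum_le_sum fun J _ => ?_
  rw [mul_assoc]
  exact mul_le_mul_of_nonneg_left
    (Nat.floor_le (mul_nonneg (p.f_nonneg J) (Nat.cast_nonneg _))) (sys.b_nonneg J I)

lemma le_created (I : UserGroup K) (t : ℕ) (ω : p.scheme.Ω) :
    p.load I * t - burst (sys := sys) I ≤ p.scheme.created I t ω := by
  rw [created_eq, load, burst, Finset.sum_mul, ← Finset.sum_sub_distrib]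
  refine Finset.sum_le_sum fun J _ => ?_
  have := mul_le_mul_of_nonneg_left (Nat.lt_floor_add_one (p.f J * t)).le (sys.b_nonneg J I)
  linarith

lemma tendsto_created_div (I : UserGroup K) (ω : p.scheme.Ω) :
    Tendsto (fun t : ℕ => p.scheme.created I t ω / t) atTop (𝓝 (p.load I)) := by
  have h1 := (tendsto_const_div_atTop_nhds_zero_nat (burst (sys := sys) I)).const_sub (p.load I)
  rw [sub_zero] at h1
  refine tendsto_of_tendsto_of_tendsto_of_le_of_le' h1 tendsto_const_nhds ?_ ?_
  · filter_upwards [eventually_gt_atTop 0] with t ht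
    have htR : (0 : ℝ) < t := by exact_mod_cast ht
    rw [le_div_iff₀ htR, sub_mul, div_mul_cancel₀ _ htR.ne']
    exact p.le_created I t ω
  · filter_upwards [eventually_gt_atTop 0] with t ht
    have htR : (0 : ℝ) < t := by exact_mod_cast ht
    rw [div_le_iff₀ htR]
    exact p.created_le I t ω

lemma arrivals_le (I : UserGroup K) (t : ℕ) (ω : p.scheme.Ω) :
    p.scheme.arrivals I t ω ≤ burst (sys := sys) I * sys.σmax := by
  unfold Scheme.arrivals burst
  rw [Finset.sum_mul]
  exact Finset.sum_le_sum fun J _ => mul_le_mul_of_nonneg_left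
    (Nat.cast_le.2 (p.scheme.σ_le t ω J)) (sys.b_nonneg J I)

lemma backlog_eq_zero_of_load {I : UserGroup K} (h : p.load I = 0) (t : ℕ) (ω : p.scheme.Ω) :
    p.scheme.Q I t ω = 0 ∧ p.scheme.created I t ω = 0 := by
  have h1 := p.created_le I t ω
  rw [h, zero_mul] at h1
  have h2 : p.scheme.Q I t ω ≤ p.scheme.created I t ω :=
    sub_nonneg.1 (p.scheme.sent_nonneg I t ω)
  have h3 := p.scheme.Q_nonneg I t ω
  constructor <;> linarith

lemma ae_tendsto_Q_div (hI : ∀ I, p.load I = 0 ∨ p.load I < p.service I) :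
    ∀ᵐ ω ∂p.scheme.prob, ∀ I,
      Tendsto (fun t : ℕ => p.scheme.Q I t ω / t) atTop (𝓝 0) := by
  refine ae_all_iff.2 fun I => ?_
  rcases hI I with h | h
  · exact ae_of_all _ fun ω => by simp [(p.backlog_eq_zero_of_load h _ ω).1]
  · filter_upwards [sys.ae_tendsto_average fun s => sys.Tslot * p.ν s I] with ω hω
    have e : ∑ s, sys.φ s * (sys.Tslot * p.ν s I) = p.service I := by
      rw [service, Finset.mul_sum]
      exact Finset.sum_congr rfl fun s _ => by ring
    rw [e] at hω
    exact tendsto_codewordBacklog_div (fun s => p.scheme.arrivals_nonneg I s ω)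
      (fun s => p.arrivals_le I s ω) h (p.tendsto_created_div I ω) hω

-- If the block of slot `s` is unsent at `t`, the bits created after it are fewer than `Q I t`, so
-- `load * (t - s - 1)` is below `burst + Q I t`. Such slots are confined to a final stretch of
-- length `o(t)`.
open Classical in
lemma tendsto_card_not_transmitted_div {ω : p.scheme.Ω} (I : UserGroup K)
    (hQ : Tendsto (fun t : ℕ => p.scheme.Q I t ω / t) atTop (𝓝 0)) :
    Tendsto (fun t : ℕ => (((Finset.range t).filter
      fun s => ¬ p.scheme.Transmitted I s t ω).card : ℝ) / t) atTop (𝓝 0) := by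
  rcases (p.load_nonneg I).eq_or_lt with h0 | h0
  · have : ∀ t : ℕ, (Finset.range t).filter (fun s => ¬ p.scheme.Transmitted I s t ω) = ∅ := by
      refine fun t => Finset.filter_false_of_mem fun s _ => not_not.2 ?_
      unfold Scheme.Transmitted Scheme.sent
      rw [(p.backlog_eq_zero_of_load h0.symm _ ω).2, (p.backlog_eq_zero_of_load h0.symm _ ω).2,
        (p.backlog_eq_zero_of_load h0.symm _ ω).1, sub_zero]
    simp [this]
  · set l := p.load I with hl
    set B := burst (sys := sys) I with hB
    have hB0 : 0 ≤ B := Finset.sum_nonneg fun J _ => sys.b_nonneg J I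
    have hlim : Tendsto (fun t : ℕ => (B / l + 1) / t + p.scheme.Q I t ω / t / l) atTop (𝓝 0) := by
      simpa using (tendsto_const_div_atTop_nhds_zero_nat (B / l + 1)).add (hQ.div_const l)
    refine squeeze_zero (fun t => by positivity) (fun t => ?_) hlim
    set y : ℝ := (B + p.scheme.Q I t ω) / l with hy
    have hy0 : 0 ≤ y := div_nonneg (add_nonneg hB0 (p.scheme.Q_nonneg I t ω)) h0.le
    have hcard : ((Finset.range t).filter fun s => ¬ p.scheme.Transmitted I s t ω).card ≤
        ⌈y⌉₊ := by
      rw [← Finset.card_range ⌈y⌉₊]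
      refine Finset.card_le_card_of_injOn (fun s => t - 1 - s) (fun s hs => ?_)
        fun s hs s' hs' h => ?_
      · obtain ⟨h1, h2⟩ := Finset.mem_filter.1 (Finset.mem_coe.1 hs)
        rw [Finset.mem_range] at h1
        rw [Finset.mem_coe, Finset.mem_range, Nat.lt_ceil, hy, lt_div_iff₀ h0]
        unfold Scheme.Transmitted Scheme.sent at h2
        have h3 := p.created_le I (s + 1) ω
        have h4 := p.le_created I t ω
        have h5 : ((t - 1 - s : ℕ) : ℝ) = t - ((s + 1 : ℕ) : ℝ) := by
          rw [← Nat.cast_sub (by omega)]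
          congr 1
          omega
        rw [h5, sub_mul]
        push Not at h2
        linarith
      · have h1 := Finset.mem_range.1 (Finset.mem_filter.1 (Finset.mem_coe.1 hs)).1
        have h2 := Finset.mem_range.1 (Finset.mem_filter.1 (Finset.mem_coe.1 hs')).1
        simp only at h
        omega
    have h6 : (((Finset.range t).filter fun s => ¬ p.scheme.Transmitted I s t ω).card : ℝ) ≤
        y + 1 := (Nat.cast_le.2 hcard).trans (Nat.ceil_lt_add_one hy0).le
    refine (div_le_div_of_nonneg_right h6 (Nat.cast_nonneg t)).trans (le_of_eq ?_)
    rw [hy]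
    ring

-- A combination not carried through has an untransmitted codeword from its own slot. The union
-- bound over codewords and groups costs only a constant factor.
open Classical in
lemma sum_x_le_carriedThrough_add (k : Fin K) (t : ℕ) (ω : p.scheme.Ω) :
    ∑ s ∈ Finset.range t, ∑ J, p.scheme.x s ω k J ≤ p.scheme.carriedThrough k t ω +
      Fintype.card (UserGroup K) * sys.σmax * ∑ I : UserGroup K,
        ((Finset.range t).filter fun s => ¬ p.scheme.Transmitted I s t ω).card := by
  have hterm : ∀ s J, p.scheme.x s ω k J ≤
      (if ∀ I : UserGroup K, I.1 ⊆ J.1 → p.scheme.Transmitted I s t ω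
        then p.scheme.x s ω k J else 0) +
      sys.σmax * ∑ I : UserGroup K, if ¬ p.scheme.Transmitted I s t ω then 1 else 0 := by
    intro s J
    split_ifs with h
    · exact Nat.le_add_right _ _
    · push Not at h
      obtain ⟨I, -, hI⟩ := h
      rw [zero_add]
      refine (p.scheme.x_le_σmax s ω k J).trans (Nat.le_mul_of_pos_right _ ?_)
      refine lt_of_lt_of_le Nat.zero_lt_one ?_
      refine le_trans (le_of_eq ?_) (Finset.single_le_sum
        (f := fun I => if ¬ p.scheme.Transmitted I s t ω then 1 else 0)
        (fun _ _ => Nat.zero_le _) (Finset.mem_univ I))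
      simp [hI]
  refine (Finset.sum_le_sum fun s _ => Finset.sum_le_sum fun J _ => hterm s J).trans
    (le_of_eq ?_)
  simp only [Finset.sum_add_distrib]
  congr 1
  simp only [Finset.sum_const, Finset.card_univ, smul_eq_mul, ← Finset.mul_sum, mul_assoc,
    Finset.card_filter]
  rw [Finset.sum_comm]

lemma carriedThrough_le_delivered (k : Fin K) (t : ℕ) (ω : p.scheme.Ω) :
    p.scheme.carriedThrough k t ω ≤ p.scheme.delivered k t ω := by
  refine Finset.sum_le_sum fun s _ => Finset.sum_le_sum fun J _ => ?_
  split_ifs with h1 h2 h2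
  · exact le_rfl
  · exact absurd (fun I _ hI => h1 I hI) h2
  · exact Nat.zero_le _
  · exact le_rfl

lemma delivered_le (k : Fin K) (t : ℕ) (ω : p.scheme.Ω) :
    p.scheme.delivered k t ω ≤ ⌊(p.r k : ℝ) * t⌋₊ := by
  rw [← p.sum_x_eq k t ω]
  refine le_trans (Finset.sum_le_sum fun s _ => Finset.sum_le_sum fun J _ => ?_)
    (Nat.le_add_right _ _)
  split_ifs
  · exact le_rfl
  · exact Nat.zero_le _

lemma tendsto_floor_div (r : ℝ≥0) :
    Tendsto (fun t : ℕ => ((⌊(r : ℝ) * t⌋₊ : ℕ) : ℝ) / t) atTop (𝓝 r) :=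
  (tendsto_nat_floor_mul_div_atTop r.2).comp tendsto_natCast_atTop_atTop

/-- Of the `⌊r k * t⌋` admitted files, a bounded number wait in the user queue, and the combined
files not carried through number `o(t)`. -/
lemma ae_tendsto_carriedThrough_div
    (hk : ∀ k, (p.r k : ℝ) ≤ ∑ J : UserGroup K with k ∈ J.1, p.f J)
    (hI : ∀ I, p.load I = 0 ∨ p.load I < p.service I) :
    ∀ᵐ ω ∂p.scheme.prob, ∀ k,
      Tendsto (fun t : ℕ => (p.scheme.carriedThrough k t ω : ℝ) / t) atTop (𝓝 (p.r k)) := by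
  classical
  filter_upwards [p.ae_tendsto_Q_div hI] with ω hω k
  obtain ⟨B, hB⟩ := p.exists_backlog_le (hk k)
  set C : ℝ := Fintype.card (UserGroup K) * sys.σmax with hC
  have h1 : Tendsto (fun t : ℕ => ((⌊(p.r k : ℝ) * t⌋₊ : ℕ) : ℝ) / t - (B : ℝ) / t -
      C * ∑ I : UserGroup K, (((Finset.range t).filter
        fun s => ¬ p.scheme.Transmitted I s t ω).card : ℝ) / t) atTop (𝓝 (p.r k)) := by
    have h2 := ((tendsto_floor_div (p.r k)).sub (tendsto_const_div_atTop_nhds_zero_nat (B : ℝ))).sub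
      ((tendsto_finsetSum Finset.univ fun I _ =>
        p.tendsto_card_not_transmitted_div I (hω I)).const_mul C)
    simpa using h2
  refine tendsto_of_tendsto_of_tendsto_of_le_of_le h1 (tendsto_floor_div (p.r k))
    (fun t => ?_) fun t => ?_
  · have h3 := p.sum_x_eq k t ω
    have h4 := p.sum_x_le_carriedThrough_add k t ω
    have h5 : ((⌊(p.r k : ℝ) * t⌋₊ : ℕ) : ℝ) ≤ p.scheme.carriedThrough k t ω +
        C * ∑ I : UserGroup K, (((Finset.range t).filter
        fun s => ¬ p.scheme.Transmitted I s t ω).card : ℝ) + B := by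
      rw [← h3]
      have := add_le_add h4 (hB t)
      rw [hC]
      exact_mod_cast this
    simp only
    rw [← Finset.sum_div, ← mul_div_assoc, ← sub_div, ← sub_div]
    exact div_le_div_of_nonneg_right (by linarith) (Nat.cast_nonneg t)
  · exact div_le_div_of_nonneg_right (Nat.cast_le.2
      ((p.carriedThrough_le_delivered k t ω).trans (p.delivered_le k t ω))) (Nat.cast_nonneg t)

lemma ae_tendsto_delivered_div
    (hk : ∀ k, (p.r k : ℝ) ≤ ∑ J : UserGroup K with k ∈ J.1, p.f J)
    (hI : ∀ I, p.load I = 0 ∨ p.load I < p.service I) :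
    ∀ᵐ ω ∂p.scheme.prob, ∀ k,
      Tendsto (fun t : ℕ => (p.scheme.delivered k t ω : ℝ) / t) atTop (𝓝 (p.r k)) := by
  filter_upwards [p.ae_tendsto_carriedThrough_div hk hI] with ω hω k
  exact tendsto_of_tendsto_of_tendsto_of_le_of_le (hω k) (tendsto_floor_div (p.r k))
    (fun t => div_le_div_of_nonneg_right
      (Nat.cast_le.2 (p.carriedThrough_le_delivered k t ω)) (Nat.cast_nonneg t))
    fun t => div_le_div_of_nonneg_right
      (Nat.cast_le.2 (p.delivered_le k t ω)) (Nat.cast_nonneg t)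

theorem hasDeliveryRate (hk : ∀ k, (p.r k : ℝ) ≤ ∑ J : UserGroup K with k ∈ J.1, p.f J)
    (hI : ∀ I, p.load I = 0 ∨ p.load I < p.service I) : p.scheme.HasDeliveryRate p.r := by
  filter_upwards [p.ae_tendsto_delivered_div hk hI] with ω hω k
  exact (tendsto_ennreal_div (hω k)).liminf_eq

theorem irrevocable (hk : ∀ k, (p.r k : ℝ) ≤ ∑ J : UserGroup K with k ∈ J.1, p.f J)
    (hI : ∀ I, p.load I = 0 ∨ p.load I < p.service I) : p.scheme.Irrevocable := by
  filter_upwards [p.ae_tendsto_delivered_div hk hI, p.ae_tendsto_carriedThrough_div hk hI]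
    with ω h1 h2 k
  simpa only [sub_div, sub_self] using (h1 k).sub (h2 k)

theorem hasAdmissionRate : p.scheme.HasAdmissionRate p.r := by
  intro k
  refine (tendsto_ennreal_div (tendsto_floor_div (p.r k))).congr fun T => ?_
  rw [← sum_floorIncrement (p.r k).coe_nonneg, Nat.cast_sum]
  congr 1
  refine Finset.sum_congr rfl fun t _ => ?_
  have : ∫⁻ _, ((floorIncrement (p.r k) t : ℕ) : ℝ≥0∞) ∂p.scheme.prob =
      (floorIncrement (p.r k) t : ℕ) := by simp
  exact this.symm

lemma sum_integral_Q_le {I : UserGroup K} (h : p.load I < p.service I) :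
    ∃ C : ℝ, ∀ T : ℕ, ∑ t ∈ Finset.range T, ∫ ω, p.scheme.Q I t ω ∂p.scheme.prob ≤ T * C := by
  obtain ⟨V, hV0, hV⟩ := sys.exists_rate_bound
  set B := burst (sys := sys) I with hB
  have hl := p.load_nonneg I
  set srv : ℕ → p.scheme.Ω → ℝ := fun t ω => sys.Tslot * p.scheme.μ t ω I with hsrv
  have hsm : ∀ t, Measurable (srv t) := fun t =>
    measurable_const.mul (p.scheme.measurable_rate t I)
  have hs0 : ∀ t ω, 0 ≤ srv t ω := fun t ω => p.scheme.service_nonneg I t ω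
  set q : ℕ → p.scheme.Ω → ℝ := fun t ω =>
    codewordBacklog (fun _ => p.load I) (fun s => srv s ω) t with hq
  -- The backlog `q (t + 1)` involves service up to slot `t` only, while `srv (t + 1)` is a function
  -- of the fresh state `h (t + 1)`; `q 0` is constant.
  have hind : ∀ t, ProbabilityTheory.IndepFun (q t) (srv t) p.scheme.prob := by
    rintro (_ | t)
    · exact ProbabilityTheory.indepFun_const_left 0 _
    · refine ProbabilityTheory.indep_of_indep_of_le_left
        (ProbabilityTheory.indep_of_indep_of_le_right (p.scheme.h_indep t) ?_) ?_
      · have h1 : Measurable fun s : Fin sys.numStates => sys.Tslot * p.ν s I :=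
          measurable_from_top
        exact (h1.comp (comap_measurable (p.scheme.h (t + 1)))).comap_le
      · have h1 : ∀ s < t + 1, Measurable[p.scheme.ℱ t] (srv s) := fun s hs => by
          have h2 : Measurable fun R : UserGroup K → ℝ => sys.Tslot * R I := by fun_prop
          exact h2.comp ((p.scheme.μ_adapted s).mono
            (p.scheme.ℱ.mono (Nat.lt_succ_iff.1 hs)) le_rfl)
        have h3 : Measurable[p.scheme.ℱ t] (q (t + 1)) :=
          @measurable_codewordBacklog _ (p.scheme.ℱ t) _ _ (t + 1)
            (fun _ _ => @measurable_const _ _ _ (p.scheme.ℱ t) _) h1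
        exact h3.comap_le
  have hmean : ∀ t, ∫ ω, srv t ω ∂p.scheme.prob = p.service I := by
    intro t
    refine (sys.integral_pathLaw (fun s => sys.Tslot * p.ν s I) t).trans ?_
    rw [service, Finset.mul_sum]
    exact Finset.sum_congr rfl fun s _ => by ring
  have hbound := sum_integral_backlog_le (V := sys.Tslot * V) hl h hsm hs0
    (fun t ω => mul_le_mul_of_nonneg_left (hV _ _ (p.scheme.μ_mem t ω) I) sys.Tslot_pos.le)
    hmean hind
  -- The true queue exceeds the one with constant inflow by at most the burst, so the Lyapunov bound
  -- transfers.
  have hQq : ∀ t ω, p.scheme.Q I t ω ≤ q t ω + B := by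
    intro t ω
    refine (codewordBacklog_le_smooth (fun t => p.le_created I t ω) t).trans ?_
    have := p.created_le I t ω
    change _ + (p.scheme.created I t ω - _ + _) ≤ _
    linarith
  have hqm : ∀ t, Measurable (q t) := fun t =>
    measurable_codewordBacklog t (fun _ _ => measurable_const) fun s _ => hsm s
  have hqi : ∀ t, Integrable (q t) p.scheme.prob := fun t =>
    Integrable.of_bound (C := t * p.load I) (hqm t).aestronglyMeasurable (ae_of_all _ fun ω => by
      rw [Real.norm_of_nonneg (codewordBacklog_nonneg (fun _ => hl) t)]
      simpa using codewordBacklog_le_sum (arr := fun _ => p.load I) (fun _ => hl)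
        (fun s => hs0 s ω) t)
  have hQi : ∀ t, Integrable (p.scheme.Q I t) p.scheme.prob := fun t =>
    ((hqi t).add (integrable_const B)).mono' (p.scheme.measurable_Q I t).aestronglyMeasurable
      (ae_of_all _ fun ω => by
        rw [Real.norm_of_nonneg (p.scheme.Q_nonneg I t ω)]
        exact hQq t ω)
  refine ⟨((sys.Tslot * V) ^ 2 + p.load I ^ 2) / (2 * (p.service I - p.load I)) + B,
    fun T => ?_⟩
  have h1 : ∀ t ∈ Finset.range T, ∫ ω, p.scheme.Q I t ω ∂p.scheme.prob ≤
      ∫ ω, q t ω ∂p.scheme.prob + B := fun t _ => by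
    refine (integral_mono (hQi t) ((hqi t).add (integrable_const B)) (hQq t)).trans (le_of_eq ?_)
    rw [integral_add' (hqi t) (integrable_const B)]
    simp
  refine (Finset.sum_le_sum h1).trans ?_
  rw [Finset.sum_add_distrib, mul_add]
  refine add_le_add (hbound T) (le_of_eq ?_)
  simp

theorem stable (hk : ∀ k, (p.r k : ℝ) ≤ ∑ J : UserGroup K with k ∈ J.1, p.f J)
    (hI : ∀ I, p.load I = 0 ∨ p.load I < p.service I) : p.scheme.Stable := by
  refine ⟨fun k => ?_, fun I => ?_⟩
  · obtain ⟨B, hB⟩ := p.exists_backlog_le (hk k)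
    refine lt_of_le_of_lt (limsup_le_of_le (h := Eventually.of_forall fun T => ?_))
      (ENNReal.natCast_lt_top B)
    refine ENNReal.div_le_of_le_mul ?_
    calc _ ≤ ∑ t ∈ Finset.range T, ∫⁻ _, (B : ℝ≥0∞) ∂p.scheme.prob :=
          Finset.sum_le_sum fun t _ => lintegral_mono fun ω => Nat.cast_le.2 (hB t)
      _ = B * T := by simp [mul_comm]
  · obtain ⟨C, hC⟩ : ∃ C : ℝ, ∀ T : ℕ,
        ∑ t ∈ Finset.range T, ∫ ω, p.scheme.Q I t ω ∂p.scheme.prob ≤ T * C := by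
      rcases hI I with h | h
      · exact ⟨0, fun T => by simp [(p.backlog_eq_zero_of_load h _ _).1]⟩
      · exact p.sum_integral_Q_le h
    refine lt_of_le_of_lt (limsup_le_of_le (h := Eventually.of_forall fun T => ?_))
      (ENNReal.ofReal_lt_top (r := C))
    refine ENNReal.div_le_of_le_mul ?_
    have hQi : ∀ t, Integrable (p.scheme.Q I t) p.scheme.prob := fun t =>
      Integrable.of_bound (C := p.load I * t) (p.scheme.measurable_Q I t).aestronglyMeasurable
        (ae_of_all _ fun ω => by
          rw [Real.norm_of_nonneg (p.scheme.Q_nonneg I t ω)]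
          exact (sub_nonneg.1 (p.scheme.sent_nonneg I t ω)).trans (p.created_le I t ω))
    have e : ∀ t, ∫⁻ ω, ENNReal.ofReal (p.scheme.Q I t ω) ∂p.scheme.prob =
        ENNReal.ofReal (∫ ω, p.scheme.Q I t ω ∂p.scheme.prob) := fun t =>
      (ofReal_integral_eq_lintegral_ofReal (hQi t)
        (ae_of_all _ fun ω => p.scheme.Q_nonneg I t ω)).symm
    simp only [e]
    rw [← ENNReal.ofReal_sum_of_nonneg fun t _ => integral_nonneg fun ω =>
      p.scheme.Q_nonneg I t ω, mul_comm, ← ENNReal.ofReal_natCast,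
      ← ENNReal.ofReal_mul (Nat.cast_nonneg T)]
    exact ENNReal.ofReal_le_ofReal (hC T)

end RatePlan

theorem exists_scheme_of_mem_interior {r : Fin K → ℝ≥0} (hr : r ∈ interior sys.Γcc) :
    ∃ π : Scheme sys,
      π.HasDeliveryRate r ∧ π.Irrevocable ∧ π.HasAdmissionRate r ∧ π.Stable := by
  obtain ⟨ν, hν, f, hf, hk, hI⟩ := sys.exists_slack_of_mem_interior hr
  let p : RatePlan sys := ⟨r, f, fun J => (hf J).1, fun J => (hf J).2, ν, hν⟩
  have hk' : ∀ k, (p.r k : ℝ) ≤ ∑ J : UserGroup K with k ∈ J.1, p.f J := fun k => (hk k).le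
  have hI' : ∀ I, p.load I = 0 ∨ p.load I < p.service I := fun I =>
    (hI I).imp_left fun h => Finset.sum_eq_zero fun J hJ => h J (Finset.mem_filter.1 hJ).2
  exact ⟨p.scheme, p.hasDeliveryRate hk' hI', p.irrevocable hk' hI', p.hasAdmissionRate,
    p.stable hk' hI'⟩

lemma interior_subset_Λcc : interior sys.Γcc ⊆ sys.Λcc := fun r hr => by
  obtain ⟨π, h1, h2, -, -⟩ := sys.exists_scheme_of_mem_interior hr
  exact ⟨π, h2, h1⟩

lemma interior_subset_stabilityRegion : interior sys.Γcc ⊆ sys.stabilityRegion := fun r hr => by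
  obtain ⟨π, -, -, h3, h4⟩ := sys.exists_scheme_of_mem_interior hr
  exact ⟨π, h3, h4⟩

end CachingSystem

/-! ### Conclusion from the sandwich between interior and region -/

lemma diff_frontier_eq_interior {X : Type*} [TopologicalSpace X] {A Γ : Set X}
    (h1 : interior Γ ⊆ A) (h2 : A ⊆ Γ) : A \ frontier Γ = interior Γ := by
  refine Set.Subset.antisymm (fun a ha => ?_) fun a ha => ⟨h1 ha, fun h => h.2 ha⟩
  by_contra hn
  exact ha.2 ⟨subset_closure (h2 ha.1), hn⟩

end

theorem lemma1 {K : ℕ} (sys : CachingSystem K) :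
    -- off the boundary of `Γ^CC`, the delivery region and the stability region are `Int Γ^CC`
    sys.Λcc \ frontier sys.Γcc = interior sys.Γcc ∧
    sys.stabilityRegion \ frontier sys.Γcc = interior sys.Γcc ∧
    -- if `σmax` files per slot exceed what any single user can receive uncoded on average,
    -- irrevocability of the combinations need not be imposed
    ((∀ k, sys.Tslot * ∑ s, sys.φ s * Real.logb 2 (1 + sys.P * sys.gain s k) ≤
        (1 - sys.m) * sys.F * sys.σmax) →
      sys.ΛccRevocable \ frontier sys.Γcc = interior sys.Γcc) ∧
    -- the two optimization problems have the same value and the same limiting optimal rates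
    (∀ α d : Fin K → ℝ, (∀ k, 0 ≤ α k) → (∀ k, 0 < d k) →
      ∃ v : ℝ,
        IsLUB (totalUtility α d '' sys.Λcc) v ∧
        IsLUB (totalUtility α d '' sys.stabilityRegion) v ∧
        {r ∈ closure sys.Λcc | totalUtility α d r = v} =
          {r ∈ closure sys.stabilityRegion | totalUtility α d r = v} ∧
        {r ∈ closure sys.Λcc | totalUtility α d r = v}.Nonempty) := by
  refine ⟨diff_frontier_eq_interior sys.interior_subset_Λcc sys.Λcc_subset_Γcc,
    diff_frontier_eq_interior sys.interior_subset_stabilityRegion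
      sys.stabilityRegion_subset_Γcc,
    fun hcap => diff_frontier_eq_interior
      (sys.interior_subset_Λcc.trans fun r ⟨π, _, h⟩ => ⟨π, h⟩)
      (sys.ΛccRevocable_subset_Γcc hcap),
    fun α d _ hd => ?_⟩
  -- Needed only for `Γcc` to be nonempty, so that the maximum is attained.
  obtain ⟨δ, -, hδ⟩ := sys.exists_const_mem_Γcc
  obtain ⟨v, ⟨r, hr, hrv⟩, h⟩ := isLUB_of_interior_subset sys.isCompact_Γcc ⟨_, hδ⟩
    sys.closure_interior_Γcc (continuous_totalUtility (α := α) hd)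
  obtain ⟨c1, l1⟩ := h _ sys.interior_subset_Λcc sys.Λcc_subset_Γcc
  obtain ⟨c2, l2⟩ := h _ sys.interior_subset_stabilityRegion sys.stabilityRegion_subset_Γcc
  refine ⟨v, l1, l2, by rw [c1, c2], r, ?_, hrv⟩
  rwa [c1]
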